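/- A hypergraph $H=(V,\mathcal E)$ consists of a finite vertex set $V$ and a set $\mathcal E$ of subsets of $V$ (hyperedges). It is $k$-uniform if every hyperedge has exactly $k$ vertices; the degree of a vertex is the number of hyperedges containing it. A set $I\subseteq V$ is independent if no hyperedge is contained in $I$, and the independence polynomial of $H$ is $$Z^{\mathrm{ly}}_H(\lambda)=\sum_{I\subseteq V\text{ independent}}\lambda^{|I|},\qquad \lambda\in\mathbb C,$$ that is, the polynomial $\sum_{I}\prod_{v\in I}\lambda_v$ with all vertex weights $\lambda_v$ equal to $\lambda$. Let $\delta>0$ be real and let $k\ge 2$ and $\Delta\ge 3$ be integers with $$\Delta\le\frac{1-\delta}{2\sqrt2\,\mathrm e\,k^2}\cdot 2^{k/2}.$$ Then there is $\varepsilon>0$, depending only on $\delta$, $k$ and $\Delta$, such that for every $k$-uniform hypergraph $H$ of maximum degree at most $\Delta$ the polynomial $Z^{\mathrm{ly}}_H$ has no zero in the open strip $\{z\in\mathbb C : |z-x|<\varepsilon\text{ for some }x\in[0,1]\}$ around $[0,1]$. -/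

import Mathlib

namespace Hypergraph

/-- Every hyperedge has exactly `k` vertices. -/
def IsUniform {V : Type*} (H : Hypergraph V) (k : ℕ) : Prop :=
  ∀ e ∈ H.edgeSet, e.encard = k

/-- The number of hyperedges that contain the vertex `v`. -/
noncomputable def degree {V : Type*} (H : Hypergraph V) (v : V) : ℕ∞ :=
  {e | e ∈ H.edgeSet ∧ v ∈ e}.encard

/-- The maximum of the vertex degrees. -/
noncomputable def maxDegree {V : Type*} (H : Hypergraph V) : ℕ∞ :=
  ⨆ v ∈ H.vertexSet, H.degree v

/-- A set of vertices is independent if no hyperedge lies entirely inside it. The set `I`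
stands for the configuration in `{0,1}^V` that takes the value `1` exactly on `I`. -/
def IsIndependent {V : Type*} (H : Hypergraph V) (I : Set V) : Prop :=
  I ⊆ H.vertexSet ∧ ∀ e ∈ H.edgeSet, ∃ v ∈ e, v ∉ I

open Classical in
/-- The (multivariate) independence polynomial of a finite hypergraph at the complex vertex
weights `w`: the sum over all independent sets `I` of the product of the weights on `I`. -/
noncomputable def leeYangZ {V : Type*} (H : Hypergraph V) (hV : H.vertexSet.Finite)
    (w : V → ℂ) : ℂ :=
  ∑ I ∈ hV.toFinset.powerset.filter (fun I : Finset V => H.IsIndependent (I : Set V)),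
    ∏ v ∈ I, w v

end Hypergraph

/-! Hyperedges are added one at a time. Adding `e` subtracts from the current sum the weight of the
configurations that contain `e`, so it suffices that this weight is at most `F` times the current
sum in norm, for a fixed `F < 1` (`norm_sum_configWeight_le`, `sum_configWeight_ne_zero`).

The quotient is a complex probability, estimated by running heat-bath dynamics from the distant
past. The complex weights are stationary for updates that propose one or zero with weights `z / (1 +
z)` and `1 / (1 + z)` (`sum_configWeight_state`); the vertices are scanned periodically. Time labels
decrease along the dynamics: the last update has label `0`, and the initial configuration sits at
`T`. A vertex is occupied only if its proposal was one, so a hyperedge can block a proposed one only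
if the latest proposals at all its other vertices were ones too. Tracing `e` back therefore explores
a percolation cluster of `k`-sets of times filled with ones, and the explored coordinates decide the
outcome (`mem_state_iff_of_agree`). If the exploration stops before `T`, the initial configuration
is irrelevant and the current sum factors out.

Uninspected coordinates sum to one under any normalised weights, so passing to norms costs a factor
`M`, close to `1`, only per inspected coordinate (`norm_sum_bernoulliWeight_le`). The explored
region is controlled by a two-tree of pairwise disjoint full sets, each full with probability at
most `P ^ k`, where `P` is close to `1 / 2`. Counting these trees (`sum_isTreeSet_le`) gives the
bound `F = 1 / D ^ 2` with `D = Δ * k ^ 2`, provided `e * D ^ 2 < 2 ^ k`. Explorations that reach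
`T` are large, and their contribution vanishes as `T` grows. -/

namespace HypergraphZeros

open Finset

/-! ### Counting rooted trees in a graph of bounded degree. -/

section TreeSets

variable {α : Type*} [DecidableEq α]

/-- `IsTreeSet N h y S`: the set `S` is the disjoint union of the root `y` and of smaller tree
sets, at most one for each element of `N y`; the underlying tree has at most `h` levels. -/
def IsTreeSet (N : α → Finset α) : ℕ → α → Finset α → Prop
  | 0, _, _ => False
  | h + 1, y, S => ∃ g : α → Finset α, (∀ z ∈ N y, g z = ∅ ∨ IsTreeSet N h z (g z)) ∧
      S = insert y ((N y).biUnion g) ∧ S.card = 1 + ∑ z ∈ N y, (g z).card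

lemma IsTreeSet.root_mem {N : α → Finset α} {h : ℕ} {y : α} {S : Finset α}
    (hS : IsTreeSet N h y S) : y ∈ S := by
  cases h with
  | zero => exact hS.elim
  | succ h =>
    obtain ⟨g, -, rfl, -⟩ := hS
    exact mem_insert_self _ _

lemma isTreeSet_singleton (N : α → Finset α) (h : ℕ) (y : α) : IsTreeSet N (h + 1) y {y} := by
  refine ⟨fun _ => ∅, fun _ _ => Or.inl rfl, ?_, ?_⟩
  · ext a; simp
  · simp

lemma IsTreeSet.succ {N : α → Finset α} {h : ℕ} {y : α} {S : Finset α}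
    (hS : IsTreeSet N h y S) : IsTreeSet N (h + 1) y S := by
  induction h generalizing y S with
  | zero => exact hS.elim
  | succ h ih =>
    obtain ⟨g, hg, h1, h2⟩ := hS
    exact ⟨g, fun z hz => (hg z hz).imp id ih, h1, h2⟩

lemma IsTreeSet.mono {N : α → Finset α} {h h' : ℕ} (hh : h ≤ h') {y : α} {S : Finset α}
    (hS : IsTreeSet N h y S) : IsTreeSet N h' y S := by
  induction hh with
  | refl => exact hS
  | step _ ih => exact ih.succ

/-- The new element becomes a leaf below `s`; the height allowance grows by one because `s` may lie
on the lowest level. This is what lets a maximal two-tree be enlarged in `exists_isTwoTree`. -/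
lemma IsTreeSet.insert {N : α → Finset α} {h : ℕ} {y : α} {S : Finset α}
    (hS : IsTreeSet N h y S) {s a : α} (hs : s ∈ S) (ha : a ∈ N s) (haS : a ∉ S) :
    IsTreeSet N (h + 1) y (insert a S) := by
  induction h generalizing y S with
  | zero => exact hS.elim
  | succ h ih =>
    obtain ⟨g, hg, h1, h2⟩ := hS
    have hsub : ∀ z ∈ N y, g z ⊆ S := fun z hz => by
      rw [h1]; exact (subset_biUnion_of_mem g hz).trans (subset_insert _ _)
    have key : ∃ z ∈ N y, IsTreeSet N (h + 1) z (Insert.insert a (g z)) := by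
      rw [h1, mem_insert, mem_biUnion] at hs
      rcases hs with rfl | ⟨z, hz, hsz⟩
      · refine ⟨a, ha, ?_⟩
        rcases hg a ha with h0 | h0
        · rw [h0]; exact isTreeSet_singleton N h a
        · exact absurd (hsub a ha h0.root_mem) haS
      · refine ⟨z, hz, ?_⟩
        rcases hg z hz with h0 | h0
        · simp [h0] at hsz
        · exact ih h0 hsz (fun h3 => haS (hsub z hz h3))
    obtain ⟨z, hz, hz2⟩ := key
    have haz : a ∉ g z := fun h3 => haS (hsub z hz h3)
    refine ⟨Function.update g z (Insert.insert a (g z)), fun u hu => ?_, ?_, ?_⟩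
    · by_cases huz : u = z
      · subst huz; right; simpa using hz2
      · rw [Function.update_of_ne huz]
        exact (hg u hu).imp id IsTreeSet.succ
    · rw [h1, Finset.insert_comm]
      congr 1
      ext b
      simp only [mem_insert, mem_biUnion]
      constructor
      · rintro (rfl | ⟨u, hu, hb⟩)
        · exact ⟨z, hz, by simp⟩
        · refine ⟨u, hu, ?_⟩
          by_cases huz : u = z
          · subst huz; simp [hb]
          · rwa [Function.update_of_ne huz]
      · rintro ⟨u, hu, hb⟩
        by_cases huz : u = z
        · subst huz
          simp only [Function.update_self, mem_insert] at hb
          exact hb.imp id fun hb => ⟨u, hu, hb⟩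
        · rw [Function.update_of_ne huz] at hb
          exact Or.inr ⟨u, hu, hb⟩
    · rw [card_insert_of_notMem haS, h2, ← add_sum_erase _ _ hz, ← add_sum_erase _ _ hz,
        Function.update_self, card_insert_of_notMem haz]
      have : ∑ u ∈ (N y).erase z, (Function.update g z (Insert.insert a (g z)) u).card
          = ∑ u ∈ (N y).erase z, (g u).card :=
        sum_congr rfl fun u hu => by rw [Function.update_of_ne (ne_of_mem_erase hu)]
      rw [this]; ring

open Classical in
/-- The generating function of tree sets in a graph of bounded degree. -/
lemma sum_isTreeSet_le {N : α → Finset α} {X : Finset α} {d : ℕ} (hNX : ∀ y ∈ X, N y ⊆ X)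
    (hd : ∀ y ∈ X, (N y).card ≤ d) {x F : ℝ} (hx : 0 ≤ x) (hF : 0 ≤ F)
    (hxF : x * (1 + F) ^ d ≤ F) (h : ℕ) {y : α} (hy : y ∈ X) :
    ∑ S ∈ X.powerset.filter (fun S => IsTreeSet N h y S), x ^ S.card ≤ F := by
  induction h generalizing y with
  | zero => exact (sum_eq_zero fun S hS => (mem_filter.1 hS).2.elim).le.trans hF
  | succ h ih =>
    set Q := X.powerset.filter (fun S => IsTreeSet N (h + 1) y S) with hQ
    have hch : ∀ S : Finset α, ∃ g : α → Finset α, S ∈ Q →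
        (∀ z ∈ N y, g z = ∅ ∨ IsTreeSet N h z (g z)) ∧
        S = insert y ((N y).biUnion g) ∧ S.card = 1 + ∑ z ∈ N y, (g z).card := by
      intro S
      by_cases hS : S ∈ Q
      · obtain ⟨g, hg⟩ := (mem_filter.1 hS).2
        exact ⟨g, fun _ => hg⟩
      · exact ⟨fun _ => ∅, fun h => absurd h hS⟩
    choose g hg using hch
    -- Each child slot holds either nothing or a smaller tree set; this is the source of the factor
    -- `1 + F` per neighbor.
    set t : α → Finset (Finset α) := fun z =>
      insert ∅ (X.powerset.filter (fun S => IsTreeSet N h z S)) with ht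
    let φ : Finset α → (∀ z ∈ N y, Finset α) := fun S z _ => g S z
    have hinj : Set.InjOn φ Q := by
      intro S hS S' hS' h3
      rw [(hg S hS).2.1, (hg S' hS').2.1]
      congr 1
      refine biUnion_congr rfl fun z hz => ?_
      exact congrFun (congrFun h3 z) hz
    have hmaps : Q.image φ ⊆ (N y).pi t := by
      intro ψ hψ
      obtain ⟨S, hS, rfl⟩ := mem_image.1 hψ
      refine mem_pi.2 fun z hz => ?_
      rw [ht, mem_insert, mem_filter, mem_powerset]
      rcases (hg S hS).1 z hz with h0 | h0
      · exact Or.inl h0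
      · refine Or.inr ⟨?_, h0⟩
        have h4 : S ⊆ X := mem_powerset.1 (mem_filter.1 hS).1
        refine Subset.trans ?_ h4
        conv_rhs => rw [(hg S hS).2.1]
        exact (subset_biUnion_of_mem (g S) hz).trans (subset_insert _ _)
    calc ∑ S ∈ Q, x ^ S.card
        = ∑ S ∈ Q, x * ∏ z ∈ (N y).attach, x ^ (φ S z.1 z.2).card := by
          refine sum_congr rfl fun S hS => ?_
          rw [(hg S hS).2.2, pow_add, pow_one, prod_pow_eq_pow_sum,
            sum_attach (N y) (fun z => (g S z).card)]
      _ = ∑ ψ ∈ Q.image φ, x * ∏ z ∈ (N y).attach, x ^ (ψ z.1 z.2).card := by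
          rw [sum_image hinj]
      _ ≤ ∑ ψ ∈ (N y).pi t, x * ∏ z ∈ (N y).attach, x ^ (ψ z.1 z.2).card :=
          sum_le_sum_of_subset_of_nonneg hmaps fun _ _ _ => by positivity
      _ = x * ∏ z ∈ N y, ∑ S ∈ t z, x ^ S.card := by
          rw [← mul_sum, prod_sum]
      _ ≤ x * ∏ z ∈ N y, (1 + F) := by
          refine mul_le_mul_of_nonneg_left (prod_le_prod (fun _ _ => by positivity) ?_) hx
          intro z hz
          rw [ht, sum_insert]
          · simpa using ih (hNX y hy hz)
          · intro h0
            have := (mem_filter.1 h0).2.root_mem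
            simp at this
      _ ≤ x * (1 + F) ^ d := by
          rw [prod_const]
          exact mul_le_mul_of_nonneg_left
            (pow_le_pow_right₀ (by linarith) (hd y hy)) hx
      _ ≤ F := hxF

end TreeSets

/-! ### Clusters, explored regions and two-trees. -/

section Percolation

variable {ι : Type*} {X : Finset (Finset ι)} {A₀ r r' : Finset ι}

/-- The members of `X` contained in `r` that are connected to `A₀` by a chain of such members. -/
inductive Cluster (X : Finset (Finset ι)) (A₀ r : Finset ι) : Finset ι → Prop
  | root : A₀ ⊆ r → Cluster X A₀ r A₀
  | step {A B : Finset ι} : Cluster X A₀ r A → B ∈ X → B ⊆ r → ¬ Disjoint A B →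
      Cluster X A₀ r B

lemma Cluster.subset {A : Finset ι} (hA : Cluster X A₀ r A) : A ⊆ r := by
  cases hA <;> assumption

lemma Cluster.mem {A : Finset ι} (hA₀ : A₀ ∈ X) (hA : Cluster X A₀ r A) : A ∈ X := by
  cases hA <;> assumption

variable [DecidableEq ι]

/-- The members of the family `X` that meet `A`. -/
def meeting (X : Finset (Finset ι)) (A : Finset ι) : Finset (Finset ι) :=
  X.filter (fun B => ¬ Disjoint A B)

/-- The members of `X` that are disjoint from `A` but meet a member of `X` meeting `A`. -/
def secondNeighbors (X : Finset (Finset ι)) (A : Finset ι) : Finset (Finset ι) :=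
  ((meeting X A).biUnion (meeting X)).filter (fun B => Disjoint A B)

open Classical in
/-- The coordinates that are inspected when the cluster of `A₀` is explored. -/
noncomputable def explored (X : Finset (Finset ι)) (A₀ r : Finset ι) : Finset ι :=
  (X.filter (fun B => B = A₀ ∨ ∃ A, Cluster X A₀ r A ∧ ¬ Disjoint A B)).biUnion id

lemma mem_explored {i : ι} : i ∈ explored X A₀ r ↔
    ∃ B ∈ X, (B = A₀ ∨ ∃ A, Cluster X A₀ r A ∧ ¬ Disjoint A B) ∧ i ∈ B := by
  simp [explored, and_assoc]

lemma root_subset_explored (hA₀ : A₀ ∈ X) : A₀ ⊆ explored X A₀ r :=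
  fun _ hi => mem_explored.2 ⟨A₀, hA₀, Or.inl rfl, hi⟩

lemma Cluster.subset_explored {A B : Finset ι} (hA : Cluster X A₀ r A) (hB : B ∈ X)
    (hAB : ¬ Disjoint A B) : B ⊆ explored X A₀ r :=
  fun _ hi => mem_explored.2 ⟨B, hB, Or.inr ⟨A, hA, hAB⟩, hi⟩

/-- Growing the cluster only ever tests the root and the sets that meet a set already reached, and
all of these lie in the explored region. -/
lemma cluster_iff_of_agree (hA₀ : A₀ ∈ X)
    (hr : ∀ i ∈ explored X A₀ r, i ∈ r ↔ i ∈ r') (A : Finset ι) :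
    Cluster X A₀ r A ↔ Cluster X A₀ r' A := by
  constructor
  · intro hA
    induction hA with
    | root h => exact .root fun i hi => (hr i (root_subset_explored hA₀ hi)).1 (h hi)
    | step h1 h2 h3 h4 ih =>
      exact .step ih h2 (fun i hi => (hr i (h1.subset_explored h2 h4 hi)).1 (h3 hi)) h4
  · intro hA
    induction hA with
    | root h => exact .root fun i hi => (hr i (root_subset_explored hA₀ hi)).2 (h hi)
    | step h1 h2 h3 h4 ih =>
      exact .step ih h2 (fun i hi => (hr i (ih.subset_explored h2 h4 hi)).2 (h3 hi)) h4

lemma explored_eq_of_agree (hA₀ : A₀ ∈ X)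
    (hr : ∀ i ∈ explored X A₀ r, i ∈ r ↔ i ∈ r') : explored X A₀ r' = explored X A₀ r := by
  ext i
  simp only [mem_explored, cluster_iff_of_agree hA₀ hr]

lemma card_meeting_biUnion_le {k D : ℕ} (hk : ∀ A ∈ X, A.card = k)
    (hD : ∀ A ∈ X, (meeting X A).card ≤ D) {S : Finset (Finset ι)} (hS : S ⊆ X) :
    (((S.biUnion (meeting X)).biUnion (meeting X)).biUnion id).card ≤ k * D ^ 2 * S.card := by
  have h1 : (S.biUnion (meeting X)).card ≤ S.card * D :=
    card_biUnion_le_card_mul _ _ _ fun A hA => hD A (hS hA)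
  have h2 : ((S.biUnion (meeting X)).biUnion (meeting X)).card ≤
      (S.biUnion (meeting X)).card * D := by
    refine card_biUnion_le_card_mul _ _ _ fun A hA => hD A ?_
    obtain ⟨B, -, hB⟩ := mem_biUnion.1 hA
    exact (mem_filter.1 hB).1
  have h3 : (((S.biUnion (meeting X)).biUnion (meeting X)).biUnion id).card ≤
      ((S.biUnion (meeting X)).biUnion (meeting X)).card * k := by
    refine card_biUnion_le_card_mul _ _ _ fun A hA => (hk A ?_).le
    obtain ⟨B, -, hB⟩ := mem_biUnion.1 hA
    exact (mem_filter.1 hB).1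
  calc _ ≤ _ := h3
    _ ≤ (S.card * D * D) * k := by gcongr; exact h2.trans (by gcongr)
    _ = _ := by ring

lemma secondNeighbors_subset (A : Finset ι) : secondNeighbors X A ⊆ X := by
  intro B hB
  obtain ⟨C, -, hC⟩ := mem_biUnion.1 (mem_filter.1 hB).1
  exact (mem_filter.1 hC).1

lemma card_secondNeighbors_le {D : ℕ} (hD : ∀ A ∈ X, (meeting X A).card ≤ D) {A : Finset ι}
    (hA : A ∈ X) : (secondNeighbors X A).card ≤ D ^ 2 := by
  refine (card_filter_le _ _).trans ?_
  have h2 := card_biUnion_le_card_mul (meeting X A) (meeting X) D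
    fun B hB => hD B (mem_filter.1 hB).1
  calc _ ≤ _ := h2
    _ ≤ D * D := by gcongr; exact hD A hA
    _ = _ := by ring

/-- Sets of pairwise disjoint members of `X` that form a tree set rooted at `A₀` for the
relation of being second neighbors. -/
def IsTwoTree (X : Finset (Finset ι)) (A₀ : Finset ι) (S : Finset (Finset ι)) : Prop :=
  S ⊆ X ∧ IsTreeSet (secondNeighbors X) S.card A₀ S ∧ (S : Set (Finset ι)).PairwiseDisjoint id

/-- The cluster of `A₀` is dominated by a two-tree of its members. -/
lemma exists_isTwoTree (hA₀ : A₀ ∈ X) (hne : A₀.Nonempty) (hr : A₀ ⊆ r) :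
    ∃ S, IsTwoTree X A₀ S ∧ (∀ A ∈ S, Cluster X A₀ r A) ∧
      ∀ A, Cluster X A₀ r A → ∃ s ∈ S, ¬ Disjoint s A := by
  classical
  -- A two-tree of largest cardinality inside the cluster is dominating.
  set Q := X.powerset.filter (fun S => IsTwoTree X A₀ S ∧ ∀ A ∈ S, Cluster X A₀ r A) with hQ
  have hQne : Q.Nonempty := by
    refine ⟨{A₀}, mem_filter.2 ⟨by simpa using hA₀, ⟨by simpa using hA₀, ?_, ?_⟩, ?_⟩⟩
    · exact isTreeSet_singleton _ 0 A₀
    · simp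
    · intro A hA
      rw [mem_singleton.1 hA]
      exact .root hr
  obtain ⟨S, hS, hmax⟩ := exists_max_image Q card hQne
  obtain ⟨-, hT, hcl⟩ := mem_filter.1 hS
  refine ⟨S, hT, hcl, fun A hA => ?_⟩
  induction hA with
  | root h =>
    exact ⟨A₀, hT.2.1.root_mem, by rwa [disjoint_self_iff_empty, ← ne_eq,
      ← nonempty_iff_ne_empty]⟩
  | @step A B h1 h2 h3 h4 ih =>
    -- If `B` were disjoint from all of `S`, then it would be a second neighbor, through `A`, of the
    -- member `s` meeting `A`; adding `B` would contradict maximality.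
    by_contra! hcon
    obtain ⟨s, hs, hsA⟩ := ih
    have hBS : B ∉ S := fun hB => by
      have := hcon B hB
      rw [disjoint_self_iff_empty] at this
      subst this
      exact h4 (disjoint_empty_right A)
    have hBs : B ∈ secondNeighbors X s :=
      mem_filter.2 ⟨mem_biUnion.2 ⟨A, mem_filter.2 ⟨h1.mem hA₀, hsA⟩,
        mem_filter.2 ⟨h2, h4⟩⟩, hcon s hs⟩
    have hnew : insert B S ∈ Q := by
      have hsub : insert B S ⊆ X := insert_subset h2 hT.1
      refine mem_filter.2 ⟨mem_powerset.2 hsub, ⟨hsub, ?_, ?_⟩, ?_⟩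
      · rw [card_insert_of_notMem hBS]
        exact hT.2.1.insert hs hBs hBS
      · rw [coe_insert]
        exact hT.2.2.insert fun C hC _ => (hcon C hC).symm
      · intro C hC
        rcases mem_insert.1 hC with rfl | hC
        · exact .step h1 h2 h3 h4
        · exact hcl C hC
    have := hmax _ hnew
    rw [card_insert_of_notMem hBS] at this
    omega

open Classical in
/-- The family of all two-trees rooted at `A₀`. -/
noncomputable def twoTrees (X : Finset (Finset ι)) (A₀ : Finset ι) :
    Finset (Finset (Finset ι)) :=
  X.powerset.filter (IsTwoTree X A₀)

lemma mem_twoTrees {S : Finset (Finset ι)} : S ∈ twoTrees X A₀ ↔ IsTwoTree X A₀ S := by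
  simp only [twoTrees, mem_filter, mem_powerset]
  exact ⟨fun h => h.2, fun h => ⟨h.1, h⟩⟩

lemma sum_twoTrees_le {D : ℕ} (hD : ∀ A ∈ X, (meeting X A).card ≤ D) (hA₀ : A₀ ∈ X)
    {x F : ℝ} (hx : 0 ≤ x) (hF : 0 ≤ F) (hxF : x * (1 + F) ^ (D ^ 2) ≤ F) :
    ∑ S ∈ twoTrees X A₀, x ^ S.card ≤ F := by
  classical
  refine le_trans (sum_le_sum_of_subset_of_nonneg ?_ fun _ _ _ => by positivity)
    (sum_isTreeSet_le (fun A _ => secondNeighbors_subset A)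
      (fun A hA => card_secondNeighbors_le hD hA) hx hF hxF X.card hA₀)
  intro S hS
  have := mem_twoTrees.1 hS
  exact mem_filter.2 ⟨mem_powerset.2 this.1, this.2.1.mono (card_le_card this.1)⟩

/-- Exponential moments of the explored region are controlled by two-trees. -/
lemma pow_card_explored_le {k D : ℕ} (hk : ∀ A ∈ X, A.card = k) (hk0 : 0 < k)
    (hD : ∀ A ∈ X, (meeting X A).card ≤ D) (hA₀ : A₀ ∈ X) (hr : A₀ ⊆ r) {M : ℝ} (hM : 1 ≤ M) :
    M ^ (explored X A₀ r).card ≤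
      ∑ S ∈ (twoTrees X A₀).filter (fun S => S.biUnion id ⊆ r ∩ explored X A₀ r),
        (M ^ (k * D ^ 2)) ^ S.card := by
  have hne : A₀.Nonempty := card_pos.1 (by rw [hk A₀ hA₀]; exact hk0)
  obtain ⟨S, hS, hSr, hdom⟩ := exists_isTwoTree hA₀ hne hr
  -- One use of `meeting` leads from the two-tree to the whole cluster, the second to the sets
  -- tested around the cluster.
  have hsub : explored X A₀ r ⊆ ((S.biUnion (meeting X)).biUnion (meeting X)).biUnion id := by
    intro i hi
    obtain ⟨B, hB, h1, hiB⟩ := mem_explored.1 hi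
    have h2 : ∃ A, Cluster X A₀ r A ∧ ¬ Disjoint A B := by
      rcases h1 with rfl | h1
      · exact ⟨B, .root hr, by
          rwa [disjoint_self_iff_empty, ← ne_eq, ← nonempty_iff_ne_empty]⟩
      · exact h1
    obtain ⟨A, hA, hAB⟩ := h2
    obtain ⟨s, hs, hsA⟩ := hdom A hA
    exact mem_biUnion.2 ⟨B, mem_biUnion.2 ⟨A, mem_biUnion.2 ⟨s, hs,
      mem_filter.2 ⟨hA.mem hA₀, hsA⟩⟩, mem_filter.2 ⟨hB, hAB⟩⟩, hiB⟩
  have hmem : S ∈ (twoTrees X A₀).filter (fun S => S.biUnion id ⊆ r ∩ explored X A₀ r) := by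
    refine mem_filter.2 ⟨mem_twoTrees.2 hS, biUnion_subset.2 fun A hA => ?_⟩
    have hAX := hS.1 hA
    refine subset_inter (hSr A hA).subset ((hSr A hA).subset_explored hAX ?_)
    rw [id, disjoint_self_iff_empty, ← ne_eq, ← nonempty_iff_ne_empty, ← card_pos, hk A hAX]
    exact hk0
  calc M ^ (explored X A₀ r).card ≤ M ^ (k * D ^ 2 * S.card) :=
        pow_le_pow_right₀ hM ((card_le_card hsub).trans (card_meeting_biUnion_le hk hD hS.1))
    _ = (M ^ (k * D ^ 2)) ^ S.card := pow_mul _ _ _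
    _ ≤ _ := single_le_sum (f := fun S : Finset (Finset ι) => (M ^ (k * D ^ 2)) ^ S.card)
        (fun _ _ => by positivity) hmem

end Percolation

/-- If all sets have span less than `n`, then an explored region that leaves the first `N`
windows of length `n` has at least `N` elements. -/
lemma le_card_explored {X : Finset (Finset ℕ)} {A₀ r : Finset ℕ} {n N : ℕ} (hA₀ : A₀ ∈ X)
    (hroot : ∀ i ∈ A₀, i < n) (hspan : ∀ A ∈ X, ∀ i ∈ A, ∀ j ∈ A, j < i + n)
    (hout : ¬ explored X A₀ r ⊆ range (N * n)) : N ≤ (explored X A₀ r).card := by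
  -- A set of span less than `n` cannot jump over a window of length `n`, so an exploration that
  -- misses the window `m` stays below `m * n`.
  have hwin : ∀ m < N, ∃ i ∈ explored X A₀ r, i / n = m := by
    intro m hm
    by_contra! hcon
    have hn : 0 < n := by
      rcases Nat.eq_zero_or_pos n with rfl | h
      · exfalso
        apply hout
        intro i hi
        obtain ⟨B, hB, -, hiB⟩ := mem_explored.1 hi
        exact absurd (hspan B hB i hiB i hiB) (by simp)
      · exact h
    have aux : ∀ B, B ⊆ explored X A₀ r → (∀ i ∈ B, i < (m + 1) * n) → ∀ i ∈ B, i < m * n := by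
      intro B hB h1 i hi
      by_contra! h2
      refine hcon i (hB hi) ?_
      rw [Nat.div_eq_iff hn]
      have := h1 i hi
      constructor
      · linarith
      · rw [add_mul, one_mul] at this; omega
    have h0 : ∀ i ∈ A₀, i < m * n := by
      refine aux A₀ (root_subset_explored hA₀) fun i hi => ?_
      have := hroot i hi
      nlinarith
    have hstep : ∀ A B, B ∈ X → ¬ Disjoint A B → (∀ i ∈ A, i < m * n) →
        ∀ i ∈ B, i < (m + 1) * n := by
      intro A B hB hAB hA i hi
      obtain ⟨j, hjA, hjB⟩ := not_disjoint_iff.1 hAB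
      have h1 := hspan B hB j hjB i hi
      have h2 := hA j hjA
      rw [add_mul, one_mul]; omega
    have hcl : ∀ A, Cluster X A₀ r A → ∀ i ∈ A, i < m * n := by
      intro A hA
      induction hA with
      | root h => exact h0
      | @step A B h1 h2 h3 h4 ih =>
        exact aux B (h1.subset_explored h2 h4) (hstep A B h2 h4 ih)
    apply hout
    intro i hi
    have hlt : i < m * n := by
      obtain ⟨B, hB, h1, hiB⟩ := mem_explored.1 hi
      rcases h1 with rfl | ⟨A, hA, hAB⟩
      · exact h0 i hiB
      · exact aux B (hA.subset_explored hB hAB) (hstep A B hB hAB (hcl A hA)) i hiB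
    rw [mem_range]
    exact hlt.trans_le (Nat.mul_le_mul_right n hm.le)
  calc N = (range N).card := (card_range N).symm
    _ ≤ ((explored X A₀ r).image (· / n)).card := by
        refine card_le_card fun m hm => ?_
        obtain ⟨i, hi, h⟩ := hwin m (mem_range.1 hm)
        exact mem_image.2 ⟨i, hi, h⟩
    _ ≤ _ := card_image_le

/-! ### Complex product weights and functions of inspected coordinates. -/

section Weights

variable {ι : Type*} [DecidableEq ι]

/-- The weight of the configuration on `R` that takes the value one exactly on `r`, when ones
have weight `p` and zeros have weight `q`. -/
def bernoulliWeight {K : Type*} [CommSemiring K] (p q : K) (R r : Finset ι) : K :=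
  ∏ i ∈ R, if i ∈ r then p else q

variable {K : Type*} [CommSemiring K] {p q p' q' : K} {R : Finset ι}

lemma sum_powerset_prod_ite (f g : ι → K) (R : Finset ι) :
    ∑ r ∈ R.powerset, ∏ i ∈ R, (if i ∈ r then f i else g i) = ∏ i ∈ R, (f i + g i) := by
  rw [prod_add]
  refine sum_congr rfl fun r hr => ?_
  rw [← prod_sdiff (mem_powerset.1 hr), mul_comm]
  congr 1
  · exact prod_congr rfl fun i hi => by simp [hi]
  · exact prod_congr rfl fun i hi => by simp [(mem_sdiff.1 hi).2]

lemma sum_bernoulliWeight (hpq : p + q = 1) (R : Finset ι) :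
    ∑ r ∈ R.powerset, bernoulliWeight p q R r = 1 := by
  simp only [bernoulliWeight]
  rw [sum_powerset_prod_ite (fun _ => p) (fun _ => q)]
  simp [hpq]

lemma bernoulliWeight_congr {r r' : Finset ι} (h : ∀ i ∈ R, i ∈ r ↔ i ∈ r') :
    bernoulliWeight p q R r = bernoulliWeight p q R r' :=
  prod_congr rfl fun i hi => by simp only [h i hi]

lemma sum_bernoulliWeight_superset (hpq : p + q = 1) {U : Finset ι} (hU : U ⊆ R) :
    ∑ r ∈ R.powerset.filter (fun r => U ⊆ r), bernoulliWeight p q R r = p ^ U.card := by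
  have h1 : ∀ r ∈ R.powerset, (if U ⊆ r then bernoulliWeight p q R r else 0) =
      ∏ i ∈ R, if i ∈ r then p else (if i ∈ U then 0 else q) := by
    intro r _
    split_ifs with h
    · refine prod_congr rfl fun i _ => ?_
      by_cases hi : i ∈ r
      · simp [hi]
      · have hiU : i ∉ U := fun h' => hi (h h')
        simp [hi, hiU]
    · obtain ⟨i, hiU, hir⟩ := not_subset.1 h
      exact (prod_eq_zero (hU hiU) (by simp [hir, hiU])).symm
  rw [sum_filter, sum_congr rfl h1, sum_powerset_prod_ite (fun _ => p)]
  have h2 : ∀ i ∈ R, (p + if i ∈ U then 0 else q) = if i ∈ U then p else 1 := by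
    intro i _
    split_ifs <;> simp [hpq]
  rw [prod_congr rfl h2, prod_ite_mem, inter_eq_right.2 hU, prod_const]

/-- A function determined by the inspection of the coordinates `C r` does not see the weights of
the other coordinates. -/
lemma sum_bernoulliWeight_mul_eq (hpq : p + q = 1) (hpq' : p' + q' = 1)
    (C : Finset ι → Finset ι) (F : Finset ι → K) (hCR : ∀ r ⊆ R, C r ⊆ R)
    (hC : ∀ r ⊆ R, ∀ r' ⊆ R, (∀ i ∈ C r, i ∈ r ↔ i ∈ r') → C r' = C r ∧ F r' = F r) :
    ∑ r ∈ R.powerset, bernoulliWeight p q R r * F r =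
      ∑ r ∈ R.powerset,
        bernoulliWeight p q (C r) r * bernoulliWeight p' q' (R \ C r) r * F r := by
  -- Fix the inspected set and the outcome on it. The other coordinates are then free, and their
  -- weights sum to one whatever `a` and `b` are, so both sides agree on each such fibre.
  have key : ∀ a b : K, a + b = 1 → ∀ r₀ ∈ R.powerset,
      ∑ r ∈ R.powerset.filter (fun r => (C r, r ∩ C r) = (C r₀, r₀ ∩ C r₀)),
        bernoulliWeight p q (C r) r * bernoulliWeight a b (R \ C r) r * F r =
      bernoulliWeight p q (C r₀) r₀ * F r₀ := by
    intro a b hab r₀ hr₀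
    have hr₀ := mem_powerset.1 hr₀
    have hCr₀ := hCR r₀ hr₀
    have agree : ∀ t, t ⊆ R \ C r₀ → ∀ i ∈ C r₀, i ∈ r₀ ↔ i ∈ (r₀ ∩ C r₀) ∪ t := by
      intro t ht i hi
      have : i ∉ t := fun h => (mem_sdiff.1 (ht h)).2 hi
      simp [hi, this]
    have hsub : ∀ t, t ⊆ R \ C r₀ → (r₀ ∩ C r₀) ∪ t ⊆ R := fun t ht =>
      union_subset (inter_subset_left.trans hr₀) (ht.trans sdiff_subset)
    rw [← mul_one (bernoulliWeight p q (C r₀) r₀ * F r₀),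
      ← sum_bernoulliWeight hab (R \ C r₀), mul_sum]
    refine sum_nbij' (fun r => r \ C r₀) (fun t => (r₀ ∩ C r₀) ∪ t) ?_ ?_ ?_ ?_ ?_
    · intro r hr
      exact mem_powerset.2 (sdiff_subset_sdiff (mem_powerset.1 (mem_filter.1 hr).1) le_rfl)
    · intro t ht
      have ht := mem_powerset.1 ht
      have h1 := (hC r₀ hr₀ _ (hsub t ht) (agree t ht)).1
      refine mem_filter.2 ⟨mem_powerset.2 (hsub t ht), Prod.ext h1 ?_⟩
      simp only [h1]
      ext i
      simp only [mem_inter]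
      constructor
      · rintro ⟨h2, h3⟩
        exact ⟨(agree t ht i h3).2 h2, h3⟩
      · rintro ⟨h2, h3⟩
        exact ⟨(agree t ht i h3).1 h2, h3⟩
    · intro r hr
      obtain ⟨h1, h2⟩ := Prod.ext_iff.1 (mem_filter.1 hr).2
      simp only at h1 h2
      rw [← h2, h1, union_comm]
      exact sdiff_union_inter r (C r₀)
    · intro t ht
      have ht := mem_powerset.1 ht
      ext i
      simp only [mem_sdiff, mem_union, mem_inter]
      constructor
      · rintro ⟨h2 | h2, h3⟩
        · exact absurd h2.2 h3
        · exact h2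
      · intro h
        exact ⟨Or.inr h, (mem_sdiff.1 (ht h)).2⟩
    · intro r hr
      obtain ⟨h1, h2⟩ := Prod.ext_iff.1 (mem_filter.1 hr).2
      simp only at h1 h2
      have hag : ∀ i ∈ C r₀, i ∈ r₀ ↔ i ∈ r := by
        intro i hi
        have := congrArg (i ∈ ·) h2
        simp only [h1, mem_inter, hi, and_true, eq_iff_iff] at this
        exact this.symm
      have h3 := (hC r₀ hr₀ r (mem_powerset.1 (mem_filter.1 hr).1) hag).2
      rw [h1, h3, bernoulliWeight_congr (r := r) (r' := r₀) fun i hi => (hag i hi).symm,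
        bernoulliWeight_congr (R := R \ C r₀) (r := r) (r' := r \ C r₀) fun i hi => by
          simp [(mem_sdiff.1 hi).2]]
      ring
  have split : ∀ r ∈ R.powerset, bernoulliWeight p q R r * F r =
      bernoulliWeight p q (C r) r * bernoulliWeight p q (R \ C r) r * F r := by
    intro r hr
    congr 1
    rw [mul_comm]
    exact (prod_sdiff (hCR r (mem_powerset.1 hr))).symm
  rw [sum_congr rfl split]
  have hmaps : ∀ r ∈ R.powerset, (C r, r ∩ C r) ∈ R.powerset.image (fun r => (C r, r ∩ C r)) :=
    fun r hr => mem_image_of_mem _ hr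
  rw [← sum_fiberwise_of_maps_to hmaps, ← sum_fiberwise_of_maps_to hmaps]
  refine sum_congr rfl fun c hc => ?_
  obtain ⟨r₀, hr₀, rfl⟩ := mem_image.1 hc
  rw [key p q hpq r₀ hr₀, key p' q' hpq' r₀ hr₀]

end Weights

lemma bernoulliWeight_nonneg {ι : Type*} [DecidableEq ι] {p q : ℝ} (hp : 0 ≤ p) (hq : 0 ≤ q)
    (R r : Finset ι) : 0 ≤ bernoulliWeight p q R r :=
  prod_nonneg fun i _ => by split_ifs <;> assumption

lemma norm_bernoulliWeight_le {ι : Type*} [DecidableEq ι] {p q : ℂ} {a b M : ℝ}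
    (hpa : ‖p‖ ≤ M * a) (hqb : ‖q‖ ≤ M * b) (R r : Finset ι) :
    ‖bernoulliWeight p q R r‖ ≤ M ^ R.card * bernoulliWeight a b R r := by
  rw [bernoulliWeight, bernoulliWeight, norm_prod, ← prod_const, ← prod_mul_distrib]
  refine prod_le_prod (fun _ _ => norm_nonneg _) fun i _ => ?_
  split_ifs <;> assumption

/-- A complex Bernoulli average is bounded by a real one, at a price that is exponential only in
the number of inspected coordinates. -/
lemma norm_sum_bernoulliWeight_le {ι : Type*} [DecidableEq ι] {R : Finset ι} {p q : ℂ}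
    {a b M : ℝ} (hpq : p + q = 1) (hab : a + b = 1) (ha : 0 ≤ a) (hb : 0 ≤ b)
    (hpa : ‖p‖ ≤ M * a) (hqb : ‖q‖ ≤ M * b)
    (C : Finset ι → Finset ι) (F : Finset ι → ℂ) (hCR : ∀ r ⊆ R, C r ⊆ R)
    (hC : ∀ r ⊆ R, ∀ r' ⊆ R, (∀ i ∈ C r, i ∈ r ↔ i ∈ r') → C r' = C r ∧ F r' = F r) :
    ‖∑ r ∈ R.powerset, bernoulliWeight p q R r * F r‖ ≤
      ∑ r ∈ R.powerset, bernoulliWeight a b R r * (M ^ (C r).card * ‖F r‖) := by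
  have hab' : (a : ℂ) + (b : ℂ) = 1 := by exact_mod_cast hab
  -- The real weights are substituted before taking norms; otherwise every coordinate of `R` would
  -- cost a factor `M`.
  rw [sum_bernoulliWeight_mul_eq hpq hab' C F hCR hC]
  refine (norm_sum_le _ _).trans (sum_le_sum fun r hr => ?_)
  rw [norm_mul, norm_mul]
  have h1 := norm_bernoulliWeight_le hpa hqb (C r) r
  have h2 : ‖bernoulliWeight (a : ℂ) (b : ℂ) (R \ C r) r‖ ≤ bernoulliWeight a b (R \ C r) r := by
    have := norm_bernoulliWeight_le (p := (a : ℂ)) (q := (b : ℂ)) (a := a) (b := b) (M := 1)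
      (by simp [abs_of_nonneg ha]) (by simp [abs_of_nonneg hb]) (R \ C r) r
    simpa using this
  have h3 : bernoulliWeight a b R r =
      bernoulliWeight a b (C r) r * bernoulliWeight a b (R \ C r) r := by
    rw [mul_comm]
    exact (prod_sdiff (hCR r (mem_powerset.1 hr))).symm
  calc _ ≤ (M ^ (C r).card * bernoulliWeight a b (C r) r) *
        bernoulliWeight a b (R \ C r) r * ‖F r‖ := by
        gcongr
        exact (norm_nonneg _).trans h1
    _ = _ := by rw [h3]; ring

/-! ### Periodic scans and the visiting times of hyperedges. -/

/-- A periodic enumeration of `V`: every window of `n` consecutive times visits every vertex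
exactly once, and `next s u` is the time of the visit of `u` in the window starting at `s`. -/
structure Scan (V : Type*) (n : ℕ) where
  /-- the vertex visited at a time -/
  vertex : ℕ → V
  /-- the first visit of a vertex, starting from a given time -/
  next : ℕ → V → ℕ
  le_next : ∀ s u, s ≤ next s u
  next_lt : ∀ s u, next s u < s + n
  vertex_next : ∀ s u, vertex (next s u) = u
  next_vertex : ∀ s t, s ≤ t → t < s + n → next s (vertex t) = t

lemma exists_scan (V : Type*) [Fintype V] [Nonempty V] : Nonempty (Scan V (Fintype.card V)) := by
  set n := Fintype.card V with hn
  have hn0 : 0 < n := Fintype.card_pos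
  let e : V ≃ Fin n := Fintype.equivFin V
  have hmod : ∀ s, n * (s / n) + s % n = s := fun s => Nat.div_add_mod s n
  have hlt : ∀ s, s % n < n := fun s => Nat.mod_lt s hn0
  refine ⟨⟨fun s => e.symm ⟨s % n, hlt s⟩, fun s u =>
    if s % n ≤ (e u : ℕ) then n * (s / n) + e u else n * (s / n) + n + e u, ?_, ?_, ?_, ?_⟩⟩
  · intro s u
    have := hmod s
    have := hlt s
    split_ifs <;> omega
  · intro s u
    have := hmod s
    have := (e u).2
    split_ifs <;> omega
  · intro s u
    have h1 : (if s % n ≤ (e u : ℕ) then n * (s / n) + (e u : ℕ) else n * (s / n) + n + e u) % n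
        = e u := by
      split_ifs
      · rw [Nat.mul_add_mod, Nat.mod_eq_of_lt (e u).2]
      · rw [add_assoc, Nat.mul_add_mod, Nat.add_mod_left, Nat.mod_eq_of_lt (e u).2]
    simp only [h1]
    exact e.symm_apply_apply u
  · intro s t hst hts
    simp only [Equiv.apply_symm_apply]
    have h1 := hmod s
    have h2 := hmod t
    have h3 := hlt s
    have h4 := hlt t
    have h5 : s / n ≤ t / n := Nat.div_le_div_right hst
    have h6 : t / n ≤ s / n + 1 := by
      have := Nat.div_le_div_right (c := n) hts.le
      rwa [Nat.add_div_right _ hn0] at this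
    rcases Nat.lt_or_ge (s / n) (t / n) with h7 | h7
    · have h8 : t / n = s / n + 1 := by omega
      rw [h8, mul_add, mul_one] at h2
      rw [if_neg (by omega)]
      exact h2
    · have h8 : t / n = s / n := by omega
      rw [h8] at h2
      rw [if_pos (by omega)]
      exact h2

namespace Scan

variable {V : Type*} {n : ℕ} (w : Scan V n)

lemma next_injective (s : ℕ) : Function.Injective (w.next s) := fun u v h => by
  rw [← w.vertex_next s u, h, w.vertex_next]

lemma next_eq_of_le {s t : ℕ} {u : V} (hst : s ≤ t) (htu : t ≤ w.next s u) :
    w.next t u = w.next s u := by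
  have h := w.next_vertex t (w.next s u) htu ((w.next_lt s u).trans_le (by omega))
  rwa [w.vertex_next] at h

/-- The times of the visits of the vertices of `e` in the window starting at `s`. -/
def visits (e : Finset V) (s : ℕ) : Finset ℕ := e.image (w.next s)

lemma mem_visits {e : Finset V} {s t : ℕ} :
    t ∈ w.visits e s ↔ s ≤ t ∧ t < s + n ∧ w.vertex t ∈ e := by
  rw [visits, mem_image]
  constructor
  · rintro ⟨u, hu, rfl⟩
    exact ⟨w.le_next s u, w.next_lt s u, by rwa [w.vertex_next]⟩
  · rintro ⟨h1, h2, h3⟩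
    exact ⟨_, h3, w.next_vertex s t h1 h2⟩

lemma card_visits (e : Finset V) (s : ℕ) : (w.visits e s).card = e.card :=
  card_image_of_injective _ (w.next_injective s)

variable [DecidableEq V]

/-- The visiting times of the sets of the family `E`, in windows that start before time `T` at a
vertex of the set. -/
def visitFamily (E : Finset (Finset V)) (T : ℕ) : Finset (Finset ℕ) :=
  E.biUnion fun e => ((range T).filter fun s => w.vertex s ∈ e).image (w.visits e)

lemma mem_visitFamily {E : Finset (Finset V)} {T : ℕ} {A : Finset ℕ} :
    A ∈ w.visitFamily E T ↔ ∃ e ∈ E, ∃ s < T, w.vertex s ∈ e ∧ w.visits e s = A := by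
  simp [visitFamily, and_assoc]

lemma visits_zero_mem_visitFamily {E : Finset (Finset V)} {T : ℕ} {e : Finset V} (he : e ∈ E)
    (hne : e.Nonempty) (hT : n ≤ T) : w.visits e 0 ∈ w.visitFamily E T := by
  have hne' : (w.visits e 0).Nonempty := hne.image _
  -- The window at `0` need not start at a vertex of `e`, but sliding it to the first visit does not
  -- change the visiting times.
  set s := (w.visits e 0).min' hne' with hs
  have hsm : s ∈ w.visits e 0 := min'_mem _ _
  obtain ⟨-, h1, h2⟩ := w.mem_visits.1 hsm
  refine w.mem_visitFamily.2 ⟨e, he, s, by omega, h2, ?_⟩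
  refine image_congr fun u hu => ?_
  refine w.next_eq_of_le (Nat.zero_le _) (min'_le _ _ ?_)
  exact mem_image_of_mem _ hu

lemma card_visitFamily_filter_mem_le {E : Finset (Finset V)} {T k Δ : ℕ}
    (hk : ∀ e ∈ E, e.card = k) (hΔ : ∀ v, (E.filter (fun e => v ∈ e)).card ≤ Δ) (t : ℕ) :
    ((w.visitFamily E T).filter (fun A => t ∈ A)).card ≤ Δ * k := by
  -- The admissible starts lie among the `n` consecutive times ending at `t`, so they visit distinct
  -- vertices of `e`: at most `k` windows per hyperedge.
  set S : Finset V → Finset ℕ := fun e =>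
    (range T).filter fun s => w.vertex s ∈ e ∧ s ≤ t ∧ t < s + n with hS
  have hScard : ∀ e, (S e).card ≤ e.card := by
    intro e
    refine card_le_card_of_injOn w.vertex (fun s hs => (mem_filter.1 hs).2.1) ?_
    intro s hs s' hs' hss
    obtain ⟨-, -, h1, h2⟩ := mem_filter.1 hs
    obtain ⟨-, -, h3, h4⟩ := mem_filter.1 hs'
    rcases le_total s s' with h | h
    · have h5 := w.next_vertex s s' h (by omega)
      have h6 := w.next_vertex s s le_rfl (by omega)
      exact h6.symm.trans ((congrArg (w.next s) hss).trans h5)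
    · have h5 := w.next_vertex s' s h (by omega)
      have h6 := w.next_vertex s' s' le_rfl (by omega)
      exact h5.symm.trans ((congrArg (w.next s') hss).trans h6)
  have hsub : (w.visitFamily E T).filter (fun A => t ∈ A) ⊆
      (E.filter (fun e => w.vertex t ∈ e)).biUnion fun e => (S e).image (w.visits e) := by
    intro A hA
    obtain ⟨h1, h2⟩ := mem_filter.1 hA
    obtain ⟨e, he, s, hs, hse, rfl⟩ := w.mem_visitFamily.1 h1
    obtain ⟨h3, h4, h5⟩ := w.mem_visits.1 h2
    exact mem_biUnion.2 ⟨e, mem_filter.2 ⟨he, h5⟩,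
      mem_image_of_mem _ (mem_filter.2 ⟨mem_range.2 hs, hse, h3, h4⟩)⟩
  calc _ ≤ _ := card_le_card hsub
    _ ≤ (E.filter (fun e => w.vertex t ∈ e)).card * k := by
        refine card_biUnion_le_card_mul _ _ _ fun e he => ?_
        exact card_image_le.trans ((hScard e).trans (hk e (mem_filter.1 he).1).le)
    _ ≤ _ := by gcongr; exact hΔ _

lemma card_meeting_visitFamily_le {E : Finset (Finset V)} {T k Δ : ℕ}
    (hk : ∀ e ∈ E, e.card = k) (hΔ : ∀ v, (E.filter (fun e => v ∈ e)).card ≤ Δ)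
    {A : Finset ℕ} (hA : A.card = k) : (meeting (w.visitFamily E T) A).card ≤ Δ * k ^ 2 := by
  have hsub : meeting (w.visitFamily E T) A ⊆
      A.biUnion fun t => (w.visitFamily E T).filter (fun B => t ∈ B) := by
    intro B hB
    obtain ⟨h1, h2⟩ := mem_filter.1 hB
    obtain ⟨t, ht, ht'⟩ := not_disjoint_iff.1 h2
    exact mem_biUnion.2 ⟨t, ht, mem_filter.2 ⟨h1, ht'⟩⟩
  calc _ ≤ _ := card_le_card hsub
    _ ≤ A.card * (Δ * k) := card_biUnion_le_card_mul _ _ _ fun t _ =>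
        w.card_visitFamily_filter_mem_le hk hΔ t
    _ = _ := by rw [hA]; ring

end Scan

/-! ### The scan dynamics and the locality of its outcome. -/

section Dynamics

variable {V : Type*} [DecidableEq V]

/-- No edge through `v` becomes full when `v` is added to `I`. -/
def IsAllowed (E : Finset (Finset V)) (v : V) (I : Finset V) : Prop :=
  ∀ e ∈ E, v ∈ e → ¬ e ⊆ insert v I

open Classical in
/-- The update of the vertex `v` in the configuration `I`, where `b` is the proposal to occupy
`v`. -/
noncomputable def update (E : Finset (Finset V)) (v : V) (b : Prop) (I : Finset V) : Finset V :=
  if b ∧ IsAllowed E v I then insert v I else I.erase v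

/-- The result of the `j` updates at the times `s + j - 1`, ..., `s + 1`, `s`, in this order. -/
noncomputable def evolve (E : Finset (Finset V)) (w : ℕ → V) (r : Finset ℕ) :
    ℕ → ℕ → Finset V → Finset V
  | _, 0, σ => σ
  | s, j + 1, σ => update E (w s) (s ∈ r) (evolve E w r (s + 1) j σ)

/-- The configuration after the updates at the times `T - 1`, ..., `s`. -/
noncomputable def state (E : Finset (Finset V)) (w : ℕ → V) (r : Finset ℕ) (T : ℕ)
    (σ : Finset V) (s : ℕ) : Finset V :=
  evolve E w r s (T - s) σ

variable {E : Finset (Finset V)} {w : ℕ → V} {r r' : Finset ℕ} {T s : ℕ} {σ σ' : Finset V}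

lemma mem_update_of_ne {v u : V} (huv : u ≠ v) {b : Prop} {I : Finset V} :
    u ∈ update E v b I ↔ u ∈ I := by
  unfold update
  split_ifs <;> simp [huv]

lemma mem_update_self {v : V} {b : Prop} {I : Finset V} :
    v ∈ update E v b I ↔ b ∧ IsAllowed E v I := by
  unfold update
  split_ifs with h <;> simp [h]

/-- The recursion of `evolve` splits off the update performed last; stationarity needs the one
performed first. -/
lemma evolve_succ (j : ℕ) (s : ℕ) (σ : Finset V) : evolve E w r s (j + 1) σ =
    evolve E w r s j (update E (w (s + j)) (s + j ∈ r) σ) := by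
  induction j generalizing s with
  | zero => rfl
  | succ j ih =>
    rw [evolve, ih, evolve]
    have : s + 1 + j = s + (j + 1) := by ring
    rw [this]

lemma evolve_congr {j : ℕ} (h : ∀ i, s ≤ i → i < s + j → (i ∈ r ↔ i ∈ r')) :
    evolve E w r s j σ = evolve E w r' s j σ := by
  induction j generalizing s with
  | zero => rfl
  | succ j ih =>
    rw [evolve, evolve, ih fun i h1 h2 => h i (by omega) (by omega)]
    simp only [h s le_rfl (by omega)]

lemma state_of_le (h : T ≤ s) : state E w r T σ s = σ := by
  rw [state, Nat.sub_eq_zero_of_le h, evolve]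

lemma state_of_lt (h : s < T) :
    state E w r T σ s = update E (w s) (s ∈ r) (state E w r T σ (s + 1)) := by
  have : T - s = (T - (s + 1)) + 1 := by omega
  rw [state, this, evolve, state]

lemma mem_state_succ_iff {u : V} (hu : w s ≠ u) :
    u ∈ state E w r T σ (s + 1) ↔ u ∈ state E w r T σ s := by
  rcases lt_or_ge s T with h | h
  · rw [state_of_lt h, mem_update_of_ne hu.symm]
  · rw [state_of_le h, state_of_le (by omega)]

variable {n : ℕ} (W : Scan V n)

/-- As labels run backwards, `W.next s u` is the most recent visit of `u`, or the slot of its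
initial value; no later update touches `u`. -/
lemma mem_state_next_iff (u : V) (s : ℕ) :
    u ∈ state E W.vertex r T σ (W.next s u) ↔ u ∈ state E W.vertex r T σ s := by
  have key : ∀ j, s + j ≤ W.next s u →
      (u ∈ state E W.vertex r T σ (s + j) ↔ u ∈ state E W.vertex r T σ s) := by
    intro j
    induction j with
    | zero => intro _; rfl
    | succ j ih =>
      intro hj
      rw [← ih (by omega), ← add_assoc]
      refine mem_state_succ_iff fun h => ?_
      have h1 := W.next_lt s u
      have := W.next_vertex s (s + j) (by omega) (by omega)
      rw [h] at this
      omega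
  have h := key (W.next s u - s)
  rw [Nat.add_sub_cancel' (W.le_next s u)] at h
  exact h le_rfl

/-- The initial configuration, encoded as the outcome of the window of times that starts at
`T`. -/
def withInitial (T : ℕ) (σ : Finset V) (r : Finset ℕ) : Finset ℕ :=
  r ∪ (Ico T (T + n)).filter (fun t => W.vertex t ∈ σ)

lemma mem_withInitial_of_lt {t : ℕ} (ht : t < T) : t ∈ withInitial W T σ r ↔ t ∈ r := by
  simp only [withInitial, mem_union, mem_filter, mem_Ico]
  constructor
  · rintro (h | h)
    · exact h
    · omega
  · exact Or.inl

lemma mem_withInitial_of_le (hr : r ⊆ range T) {t : ℕ} (ht : T ≤ t) (ht' : t < T + n) :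
    t ∈ withInitial W T σ r ↔ W.vertex t ∈ σ := by
  have : t ∉ r := fun h => by have := mem_range.1 (hr h); omega
  simp [withInitial, this, ht, ht']

lemma mem_withInitial_of_mem_state (hr : r ⊆ range T) {t : ℕ} (ht : t < T + n)
    (h : W.vertex t ∈ state E W.vertex r T σ t) : t ∈ withInitial W T σ r := by
  rcases lt_or_ge t T with h1 | h1
  · rw [mem_withInitial_of_lt W h1]
    rw [state_of_lt h1, mem_update_self] at h
    exact h.1
  · rw [mem_withInitial_of_le W hr h1 ht]
    rwa [state_of_le h1] at h

lemma lt_of_mem_visitFamily {E' : Finset (Finset V)} {A : Finset ℕ}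
    (hA : A ∈ W.visitFamily E' T) {t : ℕ} (ht : t ∈ A) : t < T + n := by
  obtain ⟨e, -, s, hs, -, rfl⟩ := W.mem_visitFamily.1 hA
  have := (W.mem_visits.1 ht).2.1
  omega

/-- The outcome of the updates at the times of the cluster is determined by the explored
coordinates. -/
lemma mem_state_iff_of_agree {E' : Finset (Finset V)} (hE : E ⊆ E') (hr : r ⊆ range T)
    (hr' : r' ⊆ range T) {A₀ : Finset ℕ} (hA₀ : A₀ ∈ W.visitFamily E' T)
    (hag : ∀ i ∈ explored (W.visitFamily E' T) A₀ (withInitial W T σ r),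
      i ∈ withInitial W T σ r ↔ i ∈ withInitial W T σ' r')
    {A : Finset ℕ} (hA : Cluster (W.visitFamily E' T) A₀ (withInitial W T σ r) A)
    {t : ℕ} (ht : t ∈ A) :
    W.vertex t ∈ state E W.vertex r T σ t ↔ W.vertex t ∈ state E W.vertex r' T σ' t := by
  -- The induction starts from the initial configuration, at the largest labels.
  induction hm : T + n - t using Nat.strong_induction_on generalizing A t with
  | _ m ih =>
    have htn := lt_of_mem_visitFamily W (hA.mem hA₀) ht
    have htρ : t ∈ withInitial W T σ r := hA.subset ht
    have hAne : ¬ Disjoint A A := fun h => by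
      rw [disjoint_self_iff_empty] at h
      simp [h] at ht
    have htρ' : t ∈ withInitial W T σ' r' :=
      (hag t (hA.subset_explored (hA.mem hA₀) hAne ht)).1 htρ
    rcases lt_or_ge t T with h1 | h1
    · rw [mem_withInitial_of_lt W h1] at htρ htρ'
      rw [state_of_lt h1, state_of_lt h1, mem_update_self, mem_update_self]
      simp only [htρ, htρ', true_and, IsAllowed]
      refine forall₂_congr fun e he => forall_congr' fun hte => not_congr ?_
      set B := W.visits e t with hB
      have htB : t ∈ B := W.mem_visits.2 ⟨le_rfl, by
        have := W.le_next t (W.vertex t)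
        have := W.next_lt t (W.vertex t)
        omega, hte⟩
      have hBX : B ∈ W.visitFamily E' T := W.mem_visitFamily.2 ⟨e, hE he, t, h1, hte, rfl⟩
      have hAB : ¬ Disjoint A B := not_disjoint_iff.2 ⟨t, ht, htB⟩
      have hBexp := hA.subset_explored hBX hAB
      have hnext : ∀ u ∈ e, W.next t u ∈ B := fun u hu => mem_image_of_mem _ hu
      have hne : ∀ u, u ≠ W.vertex t → t ≠ W.next t u := fun u hu h => hu (by
        conv_rhs => rw [h, W.vertex_next])
      have hsub : ∀ (ρ : Finset ℕ) (τ : Finset V),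
          e ⊆ insert (W.vertex t) (state E W.vertex ρ T τ (t + 1)) ↔
          ∀ u ∈ e, u ≠ W.vertex t →
            W.vertex (W.next t u) ∈ state E W.vertex ρ T τ (W.next t u) := by
        intro ρ τ
        refine forall₂_congr fun u _ => ?_
        rw [mem_insert, W.vertex_next, mem_state_next_iff]
        by_cases hu : u = W.vertex t
        · simp [hu]
        · simp [hu, mem_state_succ_iff (Ne.symm hu)]
      rw [hsub, hsub]
      -- Either `B` is full and joins the cluster, so the induction applies to its later labels, or
      -- it contains a zero, which leaves a vertex of `e` empty in both runs, so that `e` blocks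
      -- neither.
      by_cases hBr : B ⊆ withInitial W T σ r
      · have hBcl : Cluster (W.visitFamily E' T) A₀ (withInitial W T σ r) B :=
          .step hA hBX hBr hAB
        refine forall₃_congr fun u hu hut => ?_
        have h2 := W.le_next t u
        have h3 := hne u hut
        exact ih _ (by omega) hBcl (hnext u hu) rfl
      · obtain ⟨t', ht', ht'ρ⟩ := not_subset.1 hBr
        have ht'ρ' : t' ∉ withInitial W T σ' r' := fun h => ht'ρ ((hag t' (hBexp ht')).2 h)
        have ht'n := lt_of_mem_visitFamily W hBX ht'
        obtain ⟨u, hu, rfl⟩ := mem_image.1 ht'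
        have hut : u ≠ W.vertex t := by
          rintro rfl
          rw [W.next_vertex t t le_rfl (by have := W.next_lt t (W.vertex t)
                                           have := W.le_next t (W.vertex t)
                                           omega), mem_withInitial_of_lt W h1] at ht'ρ
          exact ht'ρ htρ
        constructor
        · intro h
          exact absurd (mem_withInitial_of_mem_state W hr ht'n (h u hu hut)) ht'ρ
        · intro h
          exact absurd (mem_withInitial_of_mem_state W hr' ht'n (h u hu hut)) ht'ρ'
    · rw [state_of_le h1, state_of_le h1, ← mem_withInitial_of_le W hr h1 htn,
        ← mem_withInitial_of_le W hr' h1 htn]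
      exact iff_of_true htρ htρ'

lemma subset_state_zero_iff (e : Finset V) : e ⊆ state E W.vertex r T σ 0 ↔
    ∀ t ∈ W.visits e 0, W.vertex t ∈ state E W.vertex r T σ t := by
  simp only [Scan.visits, mem_image, forall_exists_index, and_imp, forall_apply_eq_imp_iff₂,
    W.vertex_next, mem_state_next_iff]
  rfl

lemma visits_subset_of_subset_state (hr : r ⊆ range T) {e : Finset V}
    (he : e ⊆ state E W.vertex r T σ 0) : W.visits e 0 ⊆ withInitial W T σ r := by
  intro t ht
  refine mem_withInitial_of_mem_state W hr ?_ ((subset_state_zero_iff W e).1 he t ht)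
  have := (W.mem_visits.1 ht).2.1
  omega

lemma subset_state_zero_iff_of_agree {E' : Finset (Finset V)} (hE : E ⊆ E') (hr : r ⊆ range T)
    (hr' : r' ⊆ range T) {e : Finset V} (hA₀ : W.visits e 0 ∈ W.visitFamily E' T)
    (hag : ∀ i ∈ explored (W.visitFamily E' T) (W.visits e 0) (withInitial W T σ r),
      i ∈ withInitial W T σ r ↔ i ∈ withInitial W T σ' r') :
    e ⊆ state E W.vertex r T σ 0 ↔ e ⊆ state E W.vertex r' T σ' 0 := by
  by_cases h : W.visits e 0 ⊆ withInitial W T σ r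
  · rw [subset_state_zero_iff, subset_state_zero_iff]
    exact forall₂_congr fun t ht => mem_state_iff_of_agree W hE hr hr' hA₀ hag (.root h) ht
  · refine iff_of_false (fun h1 => h (visits_subset_of_subset_state W hr h1)) fun h1 => h ?_
    intro t ht
    exact (hag t (root_subset_explored hA₀ ht)).2 (visits_subset_of_subset_state W hr' h1 ht)

end Dynamics

/-! ### Stationarity of the complex weights. -/

section Stationarity

variable {V : Type*} [Fintype V] [DecidableEq V]

open Classical in
/-- The weight of a configuration: `z ^ |I|` if `I` contains no member of `E`, and zero
otherwise. -/
noncomputable def configWeight (E : Finset (Finset V)) (z : ℂ) (I : Finset V) : ℂ :=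
  if ∀ e ∈ E, ¬ e ⊆ I then z ^ I.card else 0

/-- The weights are stationary for the update of a single vertex. -/
lemma sum_configWeight_update (E : Finset (Finset V)) {z : ℂ} (hz : 1 + z ≠ 0) (v : V)
    (f : Finset V → ℂ) :
    ∑ I, configWeight E z I * (z / (1 + z) * f (update E v True I) +
      1 / (1 + z) * f (update E v False I)) = ∑ I, configWeight E z I * f I := by
  -- An update at `v` only mixes `I` and `insert v I`, so the identity is checked on each such pair.
  have hsplit : ∀ g : Finset V → ℂ, ∑ I, g I =
      ∑ I ∈ (univ.erase v).powerset, (g I + g (insert v I)) := by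
    intro g
    rw [← powerset_univ, ← insert_erase (mem_univ v), sum_powerset_insert (notMem_erase v univ),
      erase_insert (notMem_erase v univ), sum_add_distrib]
  rw [hsplit, hsplit]
  refine sum_congr rfl fun I hI => ?_
  have hvI : v ∉ I := fun h => by simpa using mem_powerset.1 hI h
  have hcard : (insert v I).card = I.card + 1 := card_insert_of_notMem hvI
  have herase : (insert v I).erase v = I := erase_insert hvI
  have hall : IsAllowed E v (insert v I) ↔ IsAllowed E v I := by simp [IsAllowed]
  have hF1 : update E v False I = I := by simp [update, hvI]
  have hF2 : update E v False (insert v I) = I := by simp [update, herase]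
  have hT : update E v True (insert v I) = update E v True I := by
    rw [update, update, insert_idem, herase, erase_eq_of_notMem hvI]
    by_cases ha : IsAllowed E v I
    · rw [if_pos ⟨trivial, hall.2 ha⟩, if_pos ⟨trivial, ha⟩]
    · rw [if_neg fun h => ha (hall.1 h.2), if_neg fun h => ha h.2]
  rw [hF1, hF2, hT]
  by_cases hind : ∀ e ∈ E, ¬ e ⊆ I
  · by_cases ha : IsAllowed E v I
    · have hind2 : ∀ e ∈ E, ¬ e ⊆ insert v I := by
        intro e he h
        by_cases hve : v ∈ e
        · exact ha e he hve h
        · exact hind e he ((subset_insert_iff_of_notMem hve).1 h)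
      have hT1 : update E v True I = insert v I := by simp [update, ha]
      rw [hT1, configWeight, configWeight, if_pos hind, if_pos hind2, hcard]
      field_simp
      ring
    · have hind2 : ¬ ∀ e ∈ E, ¬ e ⊆ insert v I := fun h => ha fun e he _ => h e he
      have hT1 : update E v True I = I := by simp [update, ha, hvI]
      rw [hT1, configWeight, configWeight, if_pos hind, if_neg hind2]
      field_simp
      ring
  · have hind2 : ¬ ∀ e ∈ E, ¬ e ⊆ insert v I := fun h =>
      hind fun e he h' => h e he (h'.trans (subset_insert _ _))
    rw [configWeight, configWeight, if_neg hind, if_neg hind2]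
    ring

/-- The weights are stationary for the composition of the updates in a time interval. -/
lemma sum_configWeight_state (E : Finset (Finset V)) {z : ℂ} (hz : 1 + z ≠ 0) (w : ℕ → V)
    (T : ℕ) (f : Finset V → ℂ) :
    ∑ σ, configWeight E z σ * ∑ r ∈ (range T).powerset,
      bernoulliWeight (z / (1 + z)) (1 / (1 + z)) (range T) r * f (state E w r T σ 0) =
      ∑ I, configWeight E z I * f I := by
  simp only [state, Nat.sub_zero]
  induction T with
  | zero => simp [evolve, bernoulliWeight]
  | succ T ih =>
    -- The update labelled `T` acts first, directly on the initial weights, and is absorbed by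
    -- one-vertex stationarity.
    rw [← ih, ← sum_configWeight_update E hz (w T) fun σ => ∑ r ∈ (range T).powerset,
      bernoulliWeight (z / (1 + z)) (1 / (1 + z)) (range T) r * f (evolve E w r 0 T σ)]
    refine sum_congr rfl fun σ _ => ?_
    congr 1
    rw [range_add_one, sum_powerset_insert notMem_range_self, mul_sum, mul_sum, add_comm]
    have hbw : ∀ r ∈ (range T).powerset, ∀ b : Prop, ∀ r', (T ∈ r' ↔ b) →
        (∀ i < T, i ∈ r' ↔ i ∈ r) →
        evolve E w r' 0 (T + 1) σ = evolve E w r 0 T (update E (w T) b σ) := by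
      intro r _ b r' hb hr'
      rw [evolve_succ, zero_add, evolve_congr (r := r') (r' := r) fun i _ hi => hr' i (by omega)]
      simp only [hb]
    congr 1
    · refine sum_congr rfl fun r hr => ?_
      rw [hbw r hr True (insert T r) (by simp) fun i hi => by simp [hi.ne], bernoulliWeight,
        prod_insert notMem_range_self, if_pos (mem_insert_self _ _), mul_assoc]
      congr 2
      exact bernoulliWeight_congr fun i hi => by simp [(mem_range.1 hi).ne]
    · refine sum_congr rfl fun r hr => ?_
      have hTr : T ∉ r := fun h => by simpa using mem_powerset.1 hr h
      rw [hbw r hr False r (by simp [hTr]) fun i hi => Iff.rfl, bernoulliWeight,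
        prod_insert notMem_range_self, if_neg hTr, mul_assoc]
      rfl

end Stationarity

/-- Exponential moments of the explored region, when all coordinates in `R` are independent and
every coordinate is one with probability at most `P`. -/
lemma sum_bernoulliWeight_explored_le {ι : Type*} [DecidableEq ι] {X : Finset (Finset ι)}
    {A₀ : Finset ι} {k D : ℕ} (hk : ∀ A ∈ X, A.card = k) (hk0 : 0 < k)
    (hD : ∀ A ∈ X, (meeting X A).card ≤ D) (hA₀ : A₀ ∈ X) {R U : Finset ι}
    (ρ : Finset ι → Finset ι) (hρ : ∀ r ⊆ R, ∀ i ∈ R, i ∈ ρ r → i ∈ r)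
    {a b P K F : ℝ} (hab : a + b = 1) (ha : 0 ≤ a) (hb : 0 ≤ b) (haP : a ≤ P) (hP0 : 0 < P)
    (hP1 : P ≤ 1) (hK : 1 ≤ K) (hF : 0 ≤ F)
    (hxF : K ^ (k * D ^ 2) * P ^ k * (1 + F) ^ (D ^ 2) ≤ F) :
    ∑ r ∈ R.powerset.filter (fun r => A₀ ⊆ ρ r ∧ explored X A₀ (ρ r) ⊆ U),
      bernoulliWeight a b R r * K ^ (explored X A₀ (ρ r)).card ≤ (P ^ (U \ R).card)⁻¹ * F := by
  set L := K ^ (k * D ^ 2) with hL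
  have hL0 : 0 ≤ L := by positivity
  set Q := (twoTrees X A₀).filter (fun S => S.biUnion id ⊆ U) with hQ
  have hW := fun r => bernoulliWeight_nonneg ha hb R r
  calc _ ≤ ∑ r ∈ R.powerset.filter (fun r => A₀ ⊆ ρ r ∧ explored X A₀ (ρ r) ⊆ U),
        ∑ S ∈ Q, if S.biUnion id ∩ R ⊆ r then bernoulliWeight a b R r * L ^ S.card else 0 := by
        refine sum_le_sum fun r hr => ?_
        obtain ⟨hrR, hr1, hr2⟩ := mem_filter.1 hr
        refine (mul_le_mul_of_nonneg_left (pow_card_explored_le hk hk0 hD hA₀ hr1 hK)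
          (hW r)).trans ?_
        rw [mul_sum, ← sum_filter]
        refine sum_le_sum_of_subset_of_nonneg ?_ fun S _ _ => mul_nonneg (hW r) (by positivity)
        intro S hS
        obtain ⟨hS1, hS2⟩ := mem_filter.1 hS
        refine mem_filter.2 ⟨mem_filter.2 ⟨hS1, (hS2.trans inter_subset_right).trans hr2⟩, ?_⟩
        intro i hi
        exact hρ r (mem_powerset.1 hrR) i (mem_inter.1 hi).2
          (mem_inter.1 (hS2 (mem_inter.1 hi).1)).1
    _ ≤ ∑ r ∈ R.powerset, ∑ S ∈ Q,
          if S.biUnion id ∩ R ⊆ r then bernoulliWeight a b R r * L ^ S.card else 0 := by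
        refine sum_le_sum_of_subset_of_nonneg (filter_subset _ _) fun r _ _ =>
          sum_nonneg fun S _ => ?_
        split_ifs
        · exact mul_nonneg (hW r) (by positivity)
        · exact le_rfl
    _ = ∑ S ∈ Q, a ^ (S.biUnion id ∩ R).card * L ^ S.card := by
        rw [sum_comm]
        refine sum_congr rfl fun S _ => ?_
        rw [← sum_filter, ← sum_mul, sum_bernoulliWeight_superset hab inter_subset_right]
    _ ≤ ∑ S ∈ Q, (P ^ (U \ R).card)⁻¹ * (L * P ^ k) ^ S.card := by
        refine sum_le_sum fun S hS => ?_
        obtain ⟨hS1, hSU⟩ := mem_filter.1 hS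
        have hS2 := mem_twoTrees.1 hS1
        have hcard : (S.biUnion id).card = S.card * k := by
          rw [card_biUnion fun A hA B hB hAB => hS2.2.2 hA hB hAB]
          exact sum_const_nat fun A hA => hk A (hS2.1 hA)
        -- Coordinates outside `R` are not random and give no factor `P`; at most `(U \ R).card`
        -- factors are lost.
        have hle : S.card * k ≤ (U \ R).card + (S.biUnion id ∩ R).card := by
          rw [← hcard, ← card_sdiff_add_card_inter (S.biUnion id) R]
          gcongr
        have hPn : 0 < P ^ (U \ R).card := by positivity
        rw [inv_mul_eq_div, le_div_iff₀ hPn]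
        calc a ^ (S.biUnion id ∩ R).card * L ^ S.card * P ^ (U \ R).card
            ≤ P ^ (S.biUnion id ∩ R).card * L ^ S.card * P ^ (U \ R).card := by gcongr
          _ = L ^ S.card * P ^ ((U \ R).card + (S.biUnion id ∩ R).card) := by
              rw [pow_add]; ring
          _ ≤ L ^ S.card * P ^ (S.card * k) :=
              mul_le_mul_of_nonneg_left (pow_le_pow_of_le_one hP0.le hP1 hle) (by positivity)
          _ = (L * P ^ k) ^ S.card := by rw [mul_pow, ← pow_mul P, mul_comm k]
    _ ≤ (P ^ (U \ R).card)⁻¹ * ∑ S ∈ twoTrees X A₀, (L * P ^ k) ^ S.card := by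
        rw [← mul_sum]
        gcongr
        exact filter_subset _ _
    _ ≤ _ := by
        gcongr
        exact sum_twoTrees_le hD hA₀ (by positivity) hF hxF

/-! ### Comparison of partition functions and absence of zeros. -/

section Zeros

variable {V : Type*} [DecidableEq V]

/-- The quantities that control the percolation argument: `M` bounds the total variation of the
complex Bernoulli weights, and `P` bounds the weight of a one. -/
structure IsControlled (k D : ℕ) (z : ℂ) (M P F : ℝ) : Prop where
  one_lt : 1 < M
  pos : 0 < P
  le_one : P ≤ 1
  nonneg : 0 ≤ F
  le : (M ^ 2) ^ (k * D ^ 2) * P ^ k * (1 + F) ^ (D ^ 2) ≤ F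
  ne_zero : 1 + z ≠ 0
  norm_add_norm_le : ‖z / (1 + z)‖ + ‖1 / (1 + z)‖ ≤ M
  norm_le : ‖z / (1 + z)‖ ≤ P

lemma agree_withInitial {n : ℕ} (W : Scan V n) {T : ℕ} {E' : Finset (Finset V)}
    {A₀ r r' : Finset ℕ} {σ : Finset V} (hr : r ⊆ range T) (hr' : r' ⊆ range T)
    (h : ∀ i ∈ explored (W.visitFamily E' T) A₀ (withInitial W T σ r) ∩ range T,
      i ∈ r ↔ i ∈ r') :
    ∀ i ∈ explored (W.visitFamily E' T) A₀ (withInitial W T σ r),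
      i ∈ withInitial W T σ r ↔ i ∈ withInitial W T σ r' := by
  intro i hi
  rcases lt_or_ge i T with h1 | h1
  · rw [mem_withInitial_of_lt W h1, mem_withInitial_of_lt W h1]
    exact h i (mem_inter.2 ⟨hi, mem_range.2 h1⟩)
  · obtain ⟨B, hB, -, hiB⟩ := mem_explored.1 hi
    have h2 := lt_of_mem_visitFamily W hB hiB
    rw [mem_withInitial_of_le W hr h1 h2, mem_withInitial_of_le W hr' h1 h2]

open Classical in
/-- The contribution to the complex probability that `e` is full after `T` updates of the
outcomes for which the event `Q` holds for the explored region. -/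
noncomputable def fullWeight {n : ℕ} (W : Scan V n) (E E' : Finset (Finset V)) (e : Finset V)
    (z : ℂ) (T : ℕ) (Q : Finset ℕ → Prop) (σ : Finset V) : ℂ :=
  ∑ r ∈ (range T).powerset, bernoulliWeight (z / (1 + z)) (1 / (1 + z)) (range T) r *
    if Q (explored (W.visitFamily E' T) (W.visits e 0) (withInitial W T σ r)) ∧
      e ⊆ state E W.vertex r T σ 0 then 1 else 0

variable {n : ℕ} (W : Scan V n) {E E' : Finset (Finset V)} {e : Finset V} {k D T : ℕ} {z : ℂ}
  {M P F : ℝ}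

/-- An exploration that stays below `T` never reads the initial configuration. -/
lemma fullWeight_eq (hE : E ⊆ E') (he : W.visits e 0 ∈ W.visitFamily E' T) (σ σ' : Finset V) :
    fullWeight W E E' e z T (· ⊆ range T) σ = fullWeight W E E' e z T (· ⊆ range T) σ' := by
  have key : ∀ r ⊆ range T, ∀ σ σ' : Finset V,
      (explored (W.visitFamily E' T) (W.visits e 0) (withInitial W T σ r) ⊆ range T ∧
        e ⊆ state E W.vertex r T σ 0) →
      (explored (W.visitFamily E' T) (W.visits e 0) (withInitial W T σ' r) ⊆ range T ∧
        e ⊆ state E W.vertex r T σ' 0) := by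
    rintro r hr σ σ' ⟨h1, h2⟩
    have hag : ∀ i ∈ explored (W.visitFamily E' T) (W.visits e 0) (withInitial W T σ r),
        i ∈ withInitial W T σ r ↔ i ∈ withInitial W T σ' r := fun i hi => by
      have := mem_range.1 (h1 hi)
      rw [mem_withInitial_of_lt W this, mem_withInitial_of_lt W this]
    rw [explored_eq_of_agree he hag]
    exact ⟨h1, (subset_state_zero_iff_of_agree W hE hr hr he hag).1 h2⟩
  refine sum_congr rfl fun r hr => ?_
  have hr := mem_powerset.1 hr
  congr 1
  split_ifs with h1 h2 h2
  · rfl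
  · exact absurd (key r hr σ σ' h1) h2
  · exact absurd (key r hr σ' σ h2) h1
  · rfl

/-- A bound for the weight of full outcomes in which the explored region is contained in `U` and
has at least `N` elements. -/
lemma norm_fullWeight_le (hz : IsControlled k D z M P F) (hk0 : 0 < k)
    (hk : ∀ A ∈ W.visitFamily E' T, A.card = k)
    (hD : ∀ A ∈ W.visitFamily E' T, (meeting (W.visitFamily E' T) A).card ≤ D)
    (hE : E ⊆ E') (he : W.visits e 0 ∈ W.visitFamily E' T) {Q : Finset ℕ → Prop}
    {U : Finset ℕ} {N : ℕ} (hQU : ∀ r, Q (explored (W.visitFamily E' T) (W.visits e 0) r) →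
      explored (W.visitFamily E' T) (W.visits e 0) r ⊆ U)
    (hQN : ∀ r, Q (explored (W.visitFamily E' T) (W.visits e 0) r) →
      N ≤ (explored (W.visitFamily E' T) (W.visits e 0) r).card) (σ : Finset V) :
    ‖fullWeight W E E' e z T Q σ‖ ≤ (M ^ N)⁻¹ * ((P ^ (U \ range T).card)⁻¹ * F) := by
  classical
  set X := W.visitFamily E' T with hX
  set A₀ := W.visits e 0 with hA₀
  set p := z / (1 + z) with hp
  set q := 1 / (1 + z) with hq
  have hpq : p + q = 1 := by
    rw [hp, hq, ← add_div, add_comm z, div_self hz.ne_zero]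
  -- Dividing the norms by `m` gives genuine probabilities; since `m ≥ 1`, that of a one stays below
  -- `P`.
  set m := ‖p‖ + ‖q‖ with hm
  have hm1 : 1 ≤ m := by
    have := norm_add_le p q
    rwa [hpq, norm_one] at this
  have hm0 : 0 < m := by linarith
  have hmM : m ≤ M := hz.norm_add_norm_le
  have hM := hz.one_lt
  have hpa : ‖p‖ ≤ M * (‖p‖ / m) := by
    rw [← mul_div_assoc, le_div_iff₀ hm0, mul_comm]
    gcongr
  have hqb : ‖q‖ ≤ M * (‖q‖ / m) := by
    rw [← mul_div_assoc, le_div_iff₀ hm0, mul_comm]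
    gcongr
  have hab : ‖p‖ / m + ‖q‖ / m = 1 := by rw [← add_div, div_self hm0.ne']
  have ha : 0 ≤ ‖p‖ / m := by positivity
  have hb : 0 ≤ ‖q‖ / m := by positivity
  have haP : ‖p‖ / m ≤ P := (div_le_self (norm_nonneg _) hm1).trans hz.norm_le
  have hagree := fun r hr r' hr' => agree_withInitial (E' := E') (A₀ := A₀) W (T := T) (r := r)
    (r' := r') (σ := σ) hr hr'
  refine (norm_sum_bernoulliWeight_le hpq hab ha hb hpa hqb
    (fun r => explored X A₀ (withInitial W T σ r) ∩ range T) _ (fun _ _ => inter_subset_right)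
    ?_).trans ?_
  · intro r hr r' hr' h
    have hag := hagree r hr r' hr' h
    have hexp := explored_eq_of_agree he hag
    rw [hexp]
    refine ⟨rfl, if_congr (and_congr_right' ?_) rfl rfl⟩
    exact (subset_state_zero_iff_of_agree W hE hr hr' he hag).symm
  · refine le_trans ?_ (mul_le_mul_of_nonneg_left
      (sum_bernoulliWeight_explored_le hk hk0 hD he (R := range T) (U := U) (withInitial W T σ)
        (fun r _ i hi h => (mem_withInitial_of_lt W (mem_range.1 hi)).1 h) hab ha hb haP hz.pos
        hz.le_one (one_le_pow₀ hM.le) hz.nonneg hz.le) (by positivity))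
    rw [mul_sum, sum_filter]
    refine sum_le_sum fun r hr => ?_
    have hW := bernoulliWeight_nonneg ha hb (range T) r
    set c := explored X A₀ (withInitial W T σ r) with hc
    by_cases hQ : Q c ∧ e ⊆ state E W.vertex r T σ 0
    · have hcN := hQN _ hQ.1
      rw [if_pos hQ, if_pos ⟨visits_subset_of_subset_state W (mem_powerset.1 hr) hQ.2,
        hQU _ hQ.1⟩, norm_one, mul_one, mul_left_comm]
      refine mul_le_mul_of_nonneg_left ?_ hW
      rw [inv_mul_eq_div, le_div_iff₀ (by positivity)]
      -- This is why `IsControlled` involves `M ^ 2`: one `M` per coordinate pays for complex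
      -- weights, the other buys the decay in `N`.
      calc M ^ (c ∩ range T).card * M ^ N ≤ M ^ c.card * M ^ c.card := by
            gcongr
            · exact hM.le
            · exact inter_subset_left
            · exact hM.le
        _ = (M ^ 2) ^ c.card := by rw [← pow_add, ← pow_mul, two_mul]
    · rw [if_neg hQ, norm_zero, mul_zero, mul_zero]
      split_ifs
      · positivity
      · exact le_rfl

variable [Fintype V]

/-- The complex probability that a further edge is full is at most `F`. -/
lemma norm_sum_configWeight_le {Δ : ℕ} (hk0 : 0 < k) (hk : ∀ e ∈ E', e.card = k)
    (hΔ : ∀ v, (E'.filter (fun e => v ∈ e)).card ≤ Δ) (hE : E ⊆ E') (he : e ∈ E')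
    (hz : IsControlled k (Δ * k ^ 2) z M P F) :
    ‖∑ I, configWeight E z I * (if e ⊆ I then 1 else 0)‖ ≤ F * ‖∑ I, configWeight E z I‖ := by
  classical
  have hne : e.Nonempty := card_pos.1 (by rwa [hk e he])
  have : Nonempty V := ⟨hne.choose⟩
  obtain ⟨W⟩ := exists_scan V
  set n := Fintype.card V with hn
  have hM := hz.one_lt
  set S := ∑ I, ‖configWeight E z I‖ with hS
  have bound : ∀ N : ℕ, ‖∑ I, configWeight E z I * (if e ⊆ I then 1 else 0)‖ ≤
      F * ‖∑ I, configWeight E z I‖ + S * ((M⁻¹) ^ (N + 1) * ((P ^ n)⁻¹ * F)) := by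
    intro N
    set T := (N + 1) * n with hT
    have hA₀ : W.visits e 0 ∈ W.visitFamily E' T :=
      W.visits_zero_mem_visitFamily he hne (by rw [hT]; nlinarith)
    have hkX : ∀ A ∈ W.visitFamily E' T, A.card = k := by
      intro A hA
      obtain ⟨e', he', s, -, -, rfl⟩ := W.mem_visitFamily.1 hA
      rw [W.card_visits, hk e' he']
    have hDX : ∀ A ∈ W.visitFamily E' T,
        (meeting (W.visitFamily E' T) A).card ≤ Δ * k ^ 2 := fun A hA =>
      W.card_meeting_visitFamily_le hk hΔ (hkX A hA)
    have hA : ∀ σ, ‖fullWeight W E E' e z T (· ⊆ range T) σ‖ ≤ F := by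
      intro σ
      have := norm_fullWeight_le W hz hk0 hkX hDX hE hA₀ (Q := (· ⊆ range T)) (U := range T)
        (N := 0) (fun r h => h) (fun r h => Nat.zero_le _) σ
      simpa using this
    have hB : ∀ σ, ‖fullWeight W E E' e z T (fun c => ¬ c ⊆ range T) σ‖ ≤
        (M⁻¹) ^ (N + 1) * ((P ^ n)⁻¹ * F) := by
      intro σ
      have hcard : (range (T + n) \ range T).card = n := by
        rw [card_sdiff_of_subset (range_subset_range.2 (by omega)), card_range, card_range]
        omega
      have := norm_fullWeight_le W hz hk0 hkX hDX hE hA₀ (Q := fun c => ¬ c ⊆ range T)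
        (U := range (T + n)) (N := N + 1) ?_ ?_ σ
      · rwa [hcard, ← inv_pow] at this
      · intro r _ i hi
        obtain ⟨B, hB, -, hiB⟩ := mem_explored.1 hi
        exact mem_range.2 (lt_of_mem_visitFamily W hB hiB)
      · intro r hr
        refine le_card_explored hA₀ (n := n) ?_ ?_ hr
        · intro i hi
          have := (W.mem_visits.1 hi).2.1
          omega
        · intro A hA i hi j hj
          obtain ⟨e', -, s, -, -, rfl⟩ := W.mem_visitFamily.1 hA
          have := W.mem_visits.1 hi
          have := W.mem_visits.1 hj
          omega
    -- The first term does not depend on `σ`; the choice of `∅` is arbitrary.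
    have hsplit : ∀ σ, ∑ r ∈ (range T).powerset,
        bernoulliWeight (z / (1 + z)) (1 / (1 + z)) (range T) r *
          (if e ⊆ state E W.vertex r T σ 0 then 1 else 0) =
        fullWeight W E E' e z T (· ⊆ range T) ∅ +
          fullWeight W E E' e z T (fun c => ¬ c ⊆ range T) σ := by
      intro σ
      rw [fullWeight_eq W hE hA₀ ∅ σ, fullWeight, fullWeight, ← sum_add_distrib]
      refine sum_congr rfl fun r _ => ?_
      rw [← mul_add]
      congr 1
      by_cases h1 : explored (W.visitFamily E' T) (W.visits e 0) (withInitial W T σ r) ⊆ range T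
        <;> by_cases h2 : e ⊆ state E W.vertex r T σ 0 <;> simp [h1, h2]
    rw [← sum_configWeight_state E hz.ne_zero W.vertex T fun I => if e ⊆ I then 1 else 0]
    simp only [hsplit, mul_add, sum_add_distrib]
    rw [← sum_mul]
    refine (norm_add_le _ _).trans (add_le_add ?_ ?_)
    · rw [norm_mul, mul_comm]
      exact mul_le_mul_of_nonneg_right (hA ∅) (norm_nonneg _)
    · rw [hS, sum_mul]
      refine (norm_sum_le _ _).trans (sum_le_sum fun σ _ => ?_)
      rw [norm_mul]
      exact mul_le_mul_of_nonneg_left (hB σ) (norm_nonneg _)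
  -- `S` and `P ^ n` depend on the hypergraph but not on `N`, so they disappear in the limit and the
  -- bound is uniform.
  have hlim : Filter.Tendsto (fun N : ℕ => F * ‖∑ I, configWeight E z I‖ +
      S * ((M⁻¹) ^ (N + 1) * ((P ^ n)⁻¹ * F))) Filter.atTop
      (nhds (F * ‖∑ I, configWeight E z I‖ + S * (0 * ((P ^ n)⁻¹ * F)))) := by
    refine Filter.Tendsto.const_add _ (Filter.Tendsto.const_mul _
      (Filter.Tendsto.mul_const _ ?_))
    exact (Filter.tendsto_add_atTop_iff_nat 1).2
      (tendsto_pow_atTop_nhds_zero_of_lt_one (by positivity) (inv_lt_one_of_one_lt₀ hM))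
  simpa using ge_of_tendsto' hlim bound

/-- The independence polynomial does not vanish where the percolation argument applies. -/
lemma sum_configWeight_ne_zero {Δ : ℕ} (hk0 : 0 < k) (hk : ∀ e ∈ E', e.card = k)
    (hΔ : ∀ v, (E'.filter (fun e => v ∈ e)).card ≤ Δ)
    (hz : IsControlled k (Δ * k ^ 2) z M P F) (hF : F < 1) (hE : E ⊆ E') :
    ∑ I, configWeight E z I ≠ 0 := by
  -- The bounds on `E'` serve for all its subfamilies; without hyperedges the sum is `(1 + z) ^
  -- |V|`.
  induction E using Finset.induction_on with
  | empty =>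
    have h := Fintype.sum_pow_mul_eq_add_pow V z 1
    simp only [one_pow, mul_one] at h
    simp only [configWeight, notMem_empty, false_implies, implies_true, if_true]
    rw [h, add_comm]
    exact pow_ne_zero _ hz.ne_zero
  | insert e E heE ih =>
    have hEE := (subset_insert e E).trans hE
    have ih := ih hEE
    have hbound := norm_sum_configWeight_le hk0 hk hΔ hEE (hE (mem_insert_self e E)) hz
    have hrec : ∑ I, configWeight (insert e E) z I =
        ∑ I, configWeight E z I - ∑ I, configWeight E z I * (if e ⊆ I then 1 else 0) := by
      rw [← sum_sub_distrib]
      refine sum_congr rfl fun I _ => ?_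
      simp only [configWeight, mem_insert, forall_eq_or_imp]
      by_cases h1 : e ⊆ I <;> by_cases h2 : ∀ e ∈ E, ¬ e ⊆ I <;> simp [h1, h2]
    rw [hrec]
    intro h0
    rw [sub_eq_zero] at h0
    rw [← h0] at hbound
    have := norm_pos_iff.2 ih
    nlinarith

end Zeros

/-! ### Choice of constants. -/

/-- Near the interval `[0, 1]` the heat-bath weights are close to genuine probabilities. -/
lemma norm_heatBath_le {z : ℂ} {x ε : ℝ} (hx0 : 0 ≤ x) (hx1 : x ≤ 1) (hε : ε ≤ 1 / 4)
    (hz : ‖z - x‖ < ε) : 1 + z ≠ 0 ∧ ‖z / (1 + z)‖ ≤ 1 / 2 + 2 * ε ∧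
      ‖z / (1 + z)‖ + ‖1 / (1 + z)‖ ≤ 1 + 4 * ε := by
  have hx : (1 + x : ℂ) ≠ 0 := by
    have : (1 + x : ℝ) ≠ 0 := by linarith
    exact_mod_cast this
  have hnx : ‖(1 + x : ℂ)‖ = 1 + x := by
    have : (1 + x : ℂ) = ((1 + x : ℝ) : ℂ) := by push_cast; rfl
    rw [this, Complex.norm_real, Real.norm_of_nonneg (by linarith)]
  have h1 : 1 / 2 ≤ ‖1 + z‖ := by
    have h2 : ‖(1 + x : ℂ)‖ ≤ ‖1 + z‖ + ‖z - x‖ := by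
      have h3 := norm_sub_le (1 + z) (z - x)
      have h4 : 1 + z - (z - x) = 1 + (x : ℂ) := by ring
      rwa [h4] at h3
    rw [hnx] at h2
    linarith
  have hz0 : 1 + z ≠ 0 := norm_pos_iff.1 (by linarith)
  have hε0 : 0 ≤ ε := (norm_nonneg _).trans hz.le
  -- This quotient is the difference between the weights of a one at `z` and at `x`.
  have hdiff : ‖(z - x) / ((1 + z) * (1 + x))‖ ≤ 2 * ε := by
    rw [norm_div, norm_mul, hnx, div_le_iff₀ (by positivity)]
    have h2 : 1 / 2 ≤ ‖1 + z‖ * (1 + x) := by nlinarith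
    nlinarith
  have hp : ‖z / (1 + z)‖ ≤ x / (1 + x) + 2 * ε := by
    have h2 : z / (1 + z) = ((x / (1 + x) : ℝ) : ℂ) + (z - x) / ((1 + z) * (1 + x)) := by
      push_cast; field_simp; ring
    rw [h2]
    refine (norm_add_le _ _).trans (add_le_add ?_ hdiff)
    rw [Complex.norm_real, Real.norm_of_nonneg (by positivity)]
  have hq : ‖1 / (1 + z)‖ ≤ 1 / (1 + x) + 2 * ε := by
    have h2 : 1 / (1 + z) = ((1 / (1 + x) : ℝ) : ℂ) - (z - x) / ((1 + z) * (1 + x)) := by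
      push_cast; field_simp; ring
    rw [h2]
    refine (norm_sub_le _ _).trans (add_le_add ?_ hdiff)
    rw [Complex.norm_real, Real.norm_of_nonneg (by positivity)]
  have hsum : x / (1 + x) + 1 / (1 + x) = 1 := by
    rw [← add_div, add_comm x, div_self (by linarith)]
  have hhalf : x / (1 + x) ≤ 1 / 2 := by
    rw [div_le_div_iff₀ (by linarith) (by norm_num)]
    linarith
  exact ⟨hz0, by linarith, by linarith⟩

/-- With `F = 1 / D ^ 2` the power of `1 + F` is at most `e`. For `ε = 0`, where `M = 1` and `P = 1
/ 2`, the requirement becomes `e * D ^ 2 < 2 ^ k`; continuity leaves room for some `ε > 0`. -/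
lemma exists_isControlled {k D : ℕ} (hD : 2 ≤ D)
    (h : Real.exp 1 * (D : ℝ) ^ 2 < 2 ^ k) :
    ∃ ε : ℝ, 0 < ε ∧ ∀ z : ℂ, (∃ x : ℝ, 0 ≤ x ∧ x ≤ 1 ∧ ‖z - x‖ < ε) →
      ∃ M P F, F < 1 ∧ IsControlled k D z M P F := by
  set g : ℝ → ℝ := fun ε => ((1 + 4 * ε) ^ 2) ^ (k * D ^ 2) * (1 / 2 + 2 * ε) ^ k *
    (Real.exp 1 * (D : ℝ) ^ 2) with hg
  have hg0 : g 0 < 1 := by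
    simp only [hg, mul_zero, add_zero, one_pow, one_mul, one_div, inv_pow]
    rw [inv_mul_eq_div, div_lt_one (by positivity)]
    exact h
  have hcont : Continuous g := by fun_prop
  have hev : ∀ᶠ ε in nhdsWithin (0 : ℝ) (Set.Ioi 0), g ε < 1 ∧ ε ∈ Set.Ioc (0 : ℝ) (1 / 4) :=
    ((hcont.tendsto 0).eventually_lt_const hg0 |>.filter_mono nhdsWithin_le_nhds).and
      (Ioc_mem_nhdsGT (by norm_num))
  obtain ⟨ε, hgε, hε0, hε4⟩ := hev.exists
  refine ⟨ε, hε0, fun z ⟨x, hx0, hx1, hzx⟩ => ?_⟩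
  obtain ⟨h1, h2, h3⟩ := norm_heatBath_le hx0 hx1 hε4 hzx
  have hD1 : (1 : ℝ) < (D : ℝ) ^ 2 := by
    have : (2 : ℝ) ≤ D := by exact_mod_cast hD
    nlinarith
  refine ⟨1 + 4 * ε, 1 / 2 + 2 * ε, ((D : ℝ) ^ 2)⁻¹, inv_lt_one_of_one_lt₀ hD1, ?_⟩
  refine ⟨by linarith, by linarith, by linarith, by positivity, ?_, h1, h3, h2⟩
  have hexp : (1 + ((D : ℝ) ^ 2)⁻¹) ^ (D ^ 2) ≤ Real.exp 1 := by
    calc (1 + ((D : ℝ) ^ 2)⁻¹) ^ (D ^ 2) ≤ Real.exp (((D : ℝ) ^ 2)⁻¹) ^ (D ^ 2) := by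
          gcongr
          rw [add_comm]
          exact Real.add_one_le_exp _
      _ = Real.exp 1 := by
          rw [← Real.exp_nat_mul]
          congr 1
          push_cast
          exact mul_inv_cancel₀ (by positivity)
  set c := ((1 + 4 * ε) ^ 2) ^ (k * D ^ 2) * (1 / 2 + 2 * ε) ^ k with hc
  have hc0 : 0 ≤ c := by positivity
  calc c * (1 + ((D : ℝ) ^ 2)⁻¹) ^ (D ^ 2) ≤ c * Real.exp 1 :=
        mul_le_mul_of_nonneg_left hexp hc0
    _ = g ε * ((D : ℝ) ^ 2)⁻¹ := by
        have : (D : ℝ) ^ 2 ≠ 0 := by positivity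
        simp only [hg, hc]
        field_simp
    _ ≤ ((D : ℝ) ^ 2)⁻¹ := mul_le_of_le_one_left (by positivity) hgε.le

lemma exp_mul_sq_lt {δ : ℝ} (hδ : 0 < δ) {k Δ : ℕ} (hk : 2 ≤ k)
    (hkΔ : (Δ : ℝ) ≤
      (1 - δ) / (2 * Real.sqrt 2 * Real.exp 1 * (k : ℝ) ^ 2) * (2 : ℝ) ^ ((k : ℝ) / 2)) :
    Real.exp 1 * ((Δ * k ^ 2 : ℕ) : ℝ) ^ 2 < 2 ^ k := by
  have hk0 : (0 : ℝ) < k := by exact_mod_cast (by omega : 0 < k)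
  have h2 : (0 : ℝ) < Real.sqrt 2 := by positivity
  have he : (1 : ℝ) < Real.exp 1 := Real.one_lt_exp_iff.2 one_pos
  set y := (2 : ℝ) ^ ((k : ℝ) / 2) with hy
  have hy0 : 0 < y := by positivity
  have hy2 : y ^ 2 = 2 ^ k := by
    rw [hy, ← Real.rpow_natCast, ← Real.rpow_mul (by norm_num), ← Real.rpow_natCast]
    congr 1
    push_cast
    ring
  rw [div_mul_eq_mul_div, le_div_iff₀ (by positivity)] at hkΔ
  -- Here `1 - δ ≤ 1`; squaring yields `8 * e ^ 2 * d ^ 2 ≤ 2 ^ k`, stronger than needed when `d ≠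
  -- 0`.
  have h3 : ((Δ * k ^ 2 : ℕ) : ℝ) * (2 * Real.sqrt 2 * Real.exp 1) ≤ y := by
    push_cast
    nlinarith
  have h4 : (((Δ * k ^ 2 : ℕ) : ℝ) * (2 * Real.sqrt 2 * Real.exp 1)) ^ 2 ≤ y ^ 2 := by
    gcongr
  set d := ((Δ * k ^ 2 : ℕ) : ℝ) with hd
  have h5 : (d * (2 * Real.sqrt 2 * Real.exp 1)) ^ 2 = 8 * Real.exp 1 ^ 2 * d ^ 2 := by
    rw [mul_pow, mul_pow, mul_pow, Real.sq_sqrt (by norm_num)]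
    ring
  rw [h5, hy2] at h4
  rcases eq_or_ne d 0 with h6 | h6
  · rw [h6]; simp
  · have h7 : 0 < d ^ 2 := by positivity
    nlinarith [mul_pos h7 (by linarith : 0 < Real.exp 1),
      mul_pos (mul_pos h7 (by linarith : 0 < Real.exp 1)) (by linarith : 0 < Real.exp 1 - 1)]

/-! ### Passage from `Hypergraph` to finite families of finite sets. -/

section Transport

variable {V : Type*} (H : Hypergraph V)

open Classical in
/-- The edges of a finite hypergraph as finite sets of vertices. -/
noncomputable def edgeFinset [Fintype H.vertexSet] : Finset (Finset H.vertexSet) :=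
  univ.filter fun S => Subtype.val '' (S : Set H.vertexSet) ∈ H.edgeSet

variable {H}

lemma mem_edgeFinset [Fintype H.vertexSet] {S : Finset H.vertexSet} :
    S ∈ edgeFinset H ↔ Subtype.val '' (S : Set H.vertexSet) ∈ H.edgeSet := by
  simp [edgeFinset]

lemma encard_image_val (S : Finset H.vertexSet) :
    (Subtype.val '' (S : Set H.vertexSet)).encard = S.card := by
  rw [Subtype.val_injective.encard_image, Set.encard_coe_eq_coe_finsetCard]

lemma card_of_mem_edgeFinset [Fintype H.vertexSet] {k : ℕ} (hk : H.IsUniform k)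
    {S : Finset H.vertexSet} (hS : S ∈ edgeFinset H) : S.card = k := by
  have := hk _ (mem_edgeFinset.1 hS)
  rw [encard_image_val] at this
  exact_mod_cast this

lemma card_edgeFinset_filter_mem_le [Fintype H.vertexSet] [DecidableEq H.vertexSet] {Δ : ℕ}
    (hΔ : H.maxDegree ≤ Δ) (v : H.vertexSet) :
    ((edgeFinset H).filter (fun S => v ∈ S)).card ≤ Δ := by
  have h1 : H.degree v ≤ Δ := (le_iSup₂ (f := fun v (_ : v ∈ H.vertexSet) => H.degree v)
    (v : V) v.2).trans hΔ
  have hinj : Function.Injective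
      fun S : Finset H.vertexSet => Subtype.val '' (S : Set H.vertexSet) := fun S S' h =>
    coe_injective (Subtype.val_injective.image_injective h)
  have h2 : ((fun S : Finset H.vertexSet => Subtype.val '' (S : Set H.vertexSet)) ''
      ((edgeFinset H).filter (fun S => v ∈ S) : Finset (Finset H.vertexSet))).encard ≤
      H.degree v := by
    refine Set.encard_le_encard ?_
    rintro _ ⟨S, hS, rfl⟩
    obtain ⟨h3, h4⟩ := mem_filter.1 (mem_coe.1 hS)
    exact ⟨mem_edgeFinset.1 h3, v, h4, rfl⟩
  rw [hinj.encard_image, Set.encard_coe_eq_coe_finsetCard] at h2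
  exact_mod_cast h2.trans h1

lemma isIndependent_map_iff [Fintype H.vertexSet] (I : Finset H.vertexSet) :
    H.IsIndependent ((I.map (Function.Embedding.subtype _) : Finset V) : Set V) ↔
      ∀ e ∈ edgeFinset H, ¬ e ⊆ I := by
  classical
  have hsub : ((I.map (Function.Embedding.subtype _) : Finset V) : Set V) =
      Subtype.val '' (I : Set H.vertexSet) := by simp
  rw [hsub]
  constructor
  · rintro ⟨-, h⟩ e he heI
    obtain ⟨_, ⟨v, hv, rfl⟩, hvI⟩ := h _ (mem_edgeFinset.1 he)
    exact hvI ⟨v, heI hv, rfl⟩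
  · intro h
    refine ⟨by simp, fun e he => ?_⟩
    by_contra! hcon
    -- Hyperedges lie in the vertex set, so `e` is recovered from its trace on the subtype.
    have heq : Subtype.val '' (((univ : Finset H.vertexSet).filter
        (fun v => (v : V) ∈ e) : Finset H.vertexSet) : Set H.vertexSet) = e := by
      ext v
      constructor
      · rintro ⟨u, hu, rfl⟩
        exact (mem_filter.1 (mem_coe.1 hu)).2
      · intro hv
        exact ⟨⟨v, H.subset_vertexSet_of_mem_edgeSet he hv⟩, by simpa using hv, rfl⟩
    refine h _ (mem_edgeFinset.2 (by rwa [heq])) fun u hu => ?_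
    obtain ⟨u', hu', h3⟩ := hcon u (mem_filter.1 hu).2
    rwa [← Subtype.val_injective h3]

lemma leeYangZ_eq [Fintype H.vertexSet] [DecidableEq H.vertexSet] (hV : H.vertexSet.Finite) (z : ℂ) :
    H.leeYangZ hV (fun _ => z) = ∑ I, configWeight (edgeFinset H) z I := by
  classical
  simp only [Hypergraph.leeYangZ, prod_const, configWeight, ← isIndependent_map_iff]
  rw [← sum_filter]
  symm
  refine sum_nbij (fun I => I.map (Function.Embedding.subtype _)) ?_ ?_ ?_ ?_
  · intro I hI
    refine mem_filter.2 ⟨mem_powerset.2 fun v hv => ?_, (mem_filter.1 hI).2⟩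
    obtain ⟨u, -, rfl⟩ := mem_map.1 hv
    simp
  · exact (map_injective _).injOn
  · intro J hJ
    obtain ⟨h1, h2⟩ := mem_filter.1 (mem_coe.1 hJ)
    have h3 : (J.subtype (· ∈ H.vertexSet)).map (Function.Embedding.subtype _) = J :=
      subtype_map_of_mem fun v hv => h2.1 hv
    refine ⟨J.subtype (· ∈ H.vertexSet), ?_, h3⟩
    refine mem_coe.2 (mem_filter.2 ⟨mem_univ _, ?_⟩)
    rw [h3]
    exact h2
  · intro I _
    rw [card_map]

end Transport

end HypergraphZeros

theorem mainTheorem4 (δ : ℝ) (hδ : 0 < δ) (k Δ : ℕ) (hk : 2 ≤ k) (hΔ : 3 ≤ Δ)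
    (hkΔ : (Δ : ℝ) ≤
      (1 - δ) / (2 * Real.sqrt 2 * Real.exp 1 * (k : ℝ) ^ 2) * (2 : ℝ) ^ ((k : ℝ) / 2)) :
    ∃ ε : ℝ, 0 < ε ∧
      ∀ (V : Type*) (H : Hypergraph V) (hV : H.vertexSet.Finite),
        H.IsUniform k → H.maxDegree ≤ (Δ : ℕ∞) →
          ∀ z : ℂ, (∃ x : ℝ, 0 ≤ x ∧ x ≤ 1 ∧ ‖z - (x : ℂ)‖ < ε) →
            H.leeYangZ hV (fun _ => z) ≠ 0 := by
  obtain ⟨ε, hε, h⟩ := HypergraphZeros.exists_isControlled (k := k) (D := Δ * k ^ 2)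
    (by nlinarith) (HypergraphZeros.exp_mul_sq_lt hδ hk hkΔ)
  refine ⟨ε, hε, fun V H hV hHk hHΔ z hz => ?_⟩
  classical
  obtain ⟨M, P, F, hF, hc⟩ := h z hz
  have : Fintype H.vertexSet := hV.fintype
  rw [HypergraphZeros.leeYangZ_eq]
  exact HypergraphZeros.sum_configWeight_ne_zero (by omega)
    (fun _ => HypergraphZeros.card_of_mem_edgeFinset hHk)
    (HypergraphZeros.card_edgeFinset_filter_mem_le hHΔ) hc hF subset_rfl
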